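/- All graphs are finite, simple and connected. For a graph $G$ and $S\subseteq V(G)$, the set $S$ is *cycle convex* if no vertex $w\in V(G)\setminus S$ lies on a cycle of $G[S\cup\{w\}]$; the *hull* $\langle S\rangle$ is the smallest cycle convex set containing $S$. A nonempty set $S\subseteq V(G)$ is *$E$-independent* if $|S|=1$ or there is $p\in S$ with $\langle S\setminus\{p\}\rangle\not\subseteq\bigcup_{a\in S\setminus\{p\}}\langle S\setminus\{a\}\rangle$, and the *exchange number* $e_{cc}(G)$ is the maximum cardinality of an $E$-independent set. A *cut vertex* is a vertex whose deletion disconnects $G$. A *block* is a maximal $2$-connected subgraph, where $K_2$ counts as $2$-connected and $K_1$ does not. An *end block* is a block containing at most one cut vertex of $G$. The blocks of $G$ *form a single chain* if they can be listed as $B_1,\dots,B_l$ such that consecutive blocks share a cut vertex and non-consecutive blocks are disjoint. Let $B$ be a block of $G$. It has the *edge-vertex property at* $x\in V(B)$ if there is an edge $uv\in E(B)$ with $d(u,x)\ge 2$ and $d(v,x)\ge 2$, and it has the *edge-vertex property* if it has it at some $x\in V(B)$. It has the *vertex-separation property* if there are a cut vertex $c$ of $G$ lying in $B$ and two distinct vertices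 $x,y\in V(B)$ such that $x$ is adjacent to $c$, and $y$ is not a cut vertex of $G$ and is adjacent neither to $c$ nor to $x$. **Theorem.** Let $G$ be a chordal graph with exactly $l$ blocks, which form a single chain, and suppose that no block is isomorphic to $K_2$. (i) If no block of $G$ has the vertex-separation property or the edge-vertex property, then $e_{cc}(G)=l+1$. (ii) If at least one block of $G$ has the vertex-separation property, or if some end block of $G$ has the edge-vertex property at a vertex $x$ that is not a cut vertex of $G$, then $e_{cc}(G)=l+2$. -/

import Mathlib

namespace CycleConvexity

variable {V : Type*}

/-- The cycle interval of `S`: the vertices of `S`, and the vertices `w` lying on a cycle of the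
subgraph induced by `S ∪ {w}`. -/
def cycleInterval (G : SimpleGraph V) (S : Set V) : Set V :=
  {w | w ∈ S ∨ ∃ c : G.Walk w w, c.IsCycle ∧ ∀ v ∈ c.support, v ∈ insert w S}

/-- `S` is cycle convex if it equals its cycle interval. -/
def IsCycleConvex (G : SimpleGraph V) (S : Set V) : Prop :=
  cycleInterval G S = S

/-- The cycle convex hull of `S`: the intersection of all cycle convex sets containing `S`. -/
def cycleHull (G : SimpleGraph V) (S : Set V) : Set V :=
  ⋂ T ∈ {T : Set V | IsCycleConvex G T ∧ S ⊆ T}, T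

theorem subset_cycleHull (G : SimpleGraph V) (S : Set V) : S ⊆ cycleHull G S := by
  intro x hx
  simp only [cycleHull, Set.mem_iInter]
  exact fun T hT => hT.2 hx

theorem cycleHull_subset (G : SimpleGraph V) {S T : Set V} (hT : IsCycleConvex G T)
    (hST : S ⊆ T) : cycleHull G S ⊆ T :=
  Set.biInter_subset_of_mem (show T ∈ {T : Set V | IsCycleConvex G T ∧ S ⊆ T} from ⟨hT, hST⟩)

/-- The hull is itself cycle convex, so it is the smallest cycle convex set containing `S`. -/
theorem isCycleConvex_cycleHull (G : SimpleGraph V) (S : Set V) :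
    IsCycleConvex G (cycleHull G S) := by
  apply Set.Subset.antisymm
  · rintro w (hw | ⟨c, hc, hs⟩)
    · exact hw
    · simp only [cycleHull, Set.mem_iInter]
      intro T hT
      have hsub : cycleHull G S ⊆ T := cycleHull_subset G hT.1 hT.2
      have h : w ∈ cycleInterval G T :=
        Or.inr ⟨c, hc, fun v hv => Set.insert_subset_insert hsub (hs v hv)⟩
      rwa [hT.1] at h
  · exact fun w hw => Or.inl hw

/-- A nonempty finite set `S` is exchange independent if it is a singleton or, for some pivot
`p ∈ S`, the hull of `S \ {p}` is not covered by the hulls of the `S \ {a}`, `a ∈ S \ {p}`. -/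
def IsExchangeIndependent (G : SimpleGraph V) (S : Finset V) : Prop :=
  S.Nonempty ∧ (S.card = 1 ∨ ∃ p ∈ S,
    ¬ cycleHull G ((S : Set V) \ {p}) ⊆
      ⋃ a ∈ (S : Set V) \ {p}, cycleHull G ((S : Set V) \ {a}))

/-- The exchange number: the maximum cardinality of an exchange independent set. -/
noncomputable def exchangeNumber (G : SimpleGraph V) : ℕ :=
  sSup {n : ℕ | ∃ S : Finset V, IsExchangeIndependent G S ∧ S.card = n}

/-- On a finite nonempty vertex set the supremum above is attained. -/
theorem exchangeNumber_isGreatest [Finite V] [Nonempty V] (G : SimpleGraph V) :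
    IsGreatest {n : ℕ | ∃ S : Finset V, IsExchangeIndependent G S ∧ S.card = n}
      (exchangeNumber G) := by
  have hb : BddAbove {n : ℕ | ∃ S : Finset V, IsExchangeIndependent G S ∧ S.card = n} := by
    have := Fintype.ofFinite V
    refine ⟨Fintype.card V, ?_⟩
    rintro n ⟨S, -, rfl⟩
    exact Finset.card_le_univ S
  have hne : {n : ℕ | ∃ S : Finset V, IsExchangeIndependent G S ∧ S.card = n}.Nonempty := by
    obtain ⟨v⟩ := ‹Nonempty V›
    exact ⟨1, {v}, ⟨⟨v, by simp⟩, Or.inl (by simp)⟩, by simp⟩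
  exact ⟨Nat.sSup_mem hne hb, fun n hn => le_csSup hb hn⟩

/-- Every cycle of length at least four has a chord. -/
def IsChordal (G : SimpleGraph V) : Prop :=
  ∀ (v : V) (c : G.Walk v v), c.IsCycle → 4 ≤ c.length →
    ∃ x ∈ c.support, ∃ y ∈ c.support, G.Adj x y ∧ s(x, y) ∉ c.edges

/-- `v` is a cut vertex if deleting it leaves a disconnected graph. The graph without vertices
does not count as disconnected here. -/
def IsCutVertex (G : SimpleGraph V) (v : V) : Prop :=
  ¬ (G.induce {v}ᶜ).Preconnected

/-- A subgraph is 2-connected if it is connected and stays connected (in particular nonempty)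
after the deletion of any one of its vertices. So `K₂` is 2-connected and `K₁` is not. -/
def IsTwoConnected {G : SimpleGraph V} (H : G.Subgraph) : Prop :=
  H.Connected ∧ ∀ v ∈ H.verts, (H.deleteVerts {v}).Connected

/-- A block is a maximal 2-connected subgraph. -/
def IsBlock (G : SimpleGraph V) (B : G.Subgraph) : Prop :=
  Maximal (fun H : G.Subgraph => IsTwoConnected H) B

/-- An end block: a block with at most one cut vertex of `G`. It has exactly one unless it is the
only block of a connected graph. -/
def IsEndBlock (G : SimpleGraph V) (B : G.Subgraph) : Prop :=
  IsBlock G B ∧ {c : V | c ∈ B.verts ∧ IsCutVertex G c}.Subsingleton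

/-- `G` has exactly `l` blocks and they form a single chain: they can be listed so that consecutive
blocks share a cut vertex and non-consecutive blocks are disjoint. -/
def BlocksFormSingleChain (G : SimpleGraph V) (l : ℕ) : Prop :=
  ∃ B : Fin l → G.Subgraph, Function.Injective B ∧ Set.range B = {H | IsBlock G H} ∧
    (∀ i j : Fin l, (i : ℕ) + 1 = j →
      ∃ c, IsCutVertex G c ∧ c ∈ (B i).verts ∧ c ∈ (B j).verts) ∧
    (∀ i j : Fin l, (i : ℕ) + 1 < j → Disjoint (B i).verts (B j).verts)

/-- The vertex `x` of `B` is at distance at least two from both ends of some edge of `B`. -/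
def EdgeVertexAt (G : SimpleGraph V) (B : G.Subgraph) (x : V) : Prop :=
  x ∈ B.verts ∧ ∃ u v, B.Adj u v ∧ 2 ≤ G.dist u x ∧ 2 ≤ G.dist v x

/-- The edge-vertex property of a block. -/
def HasEdgeVertexProperty (G : SimpleGraph V) (B : G.Subgraph) : Prop :=
  ∃ x, EdgeVertexAt G B x

/-- The vertex-separation property of a block `B`: there are a cut vertex `c` of `G` in `B`, a
neighbour `x ∈ B` of `c`, and a vertex `y ∈ B`, `y ≠ x`, which is not a cut vertex and is adjacent
neither to `c` nor to `x`. -/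
def HasVertexSeparationProperty (G : SimpleGraph V) (B : G.Subgraph) : Prop :=
  ∃ c x y, IsCutVertex G c ∧ c ∈ B.verts ∧ x ∈ B.verts ∧ y ∈ B.verts ∧ x ≠ y ∧ G.Adj c x ∧
    ¬ IsCutVertex G y ∧ ¬ G.Adj c y ∧ ¬ G.Adj x y

end CycleConvexity

/-! In a chordal graph a set is cycle convex exactly when it is closed under completing triangles,
because chords cut any cycle into triangles. Such a set contains a whole block as soon as it
contains one edge of it. Convexity therefore depends only on the blocks: a block fires when two
adjacent vertices of it are present, and then all its vertices are. The hull is what repeated firing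
produces (`Generated`, `IsBlockChain.mem_cycleHull_iff`).

Upper bound. Let `t` be generated from `S` by a set `J` of blocks of the chain. Either some block
can be dropped, or a block containing `t` fires on an edge `uv` with `u` generated by the blocks of
`J` on its left and `v` by those on its right. By induction `|J| + 1` vertices of `S` suffice
(`IsBlockChain.exists_finset_generated`). Hence an independent set has at most `l + 1` vertices
besides its pivot `p`. Without the edge-vertex property, `p` equals or is adjacent to an end of
every edge of its block, so `p` can replace one branch of the derivation. As `p` survives the
removal of any other vertex, this saves one vertex (`IsBlockChain.exists_finset_generated_insert`).

Lower bound. Choose `d 0, …, d l` passing through the cut vertices, and for each `i` a neighbour `q`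
of `d i` in `β i` other than `d (i + 1)`. These neighbours and `d 0` are `l + 1` vertices generating
`d l` block by block, and the loss of any one of them stops the process (`IsCriticalChain`).
Stopping one block earlier leaves `d l` free to be a pivot, which gives `l + 1`. A vertex `y` of
some block that is adjacent neither to `d i` nor to `q` is a pivot for the full chain, which gives
`l + 2`. The vertex-separation property supplies such a `y`, except when its `x` is the next cut
vertex; then two chains, one from each end, meet at the edge `cx`. The edge-vertex property of an
end block either reduces to vertex separation or lets the chain start on the given edge. -/

open SimpleGraph

namespace CycleConvexity

variable {V : Type*} {G : SimpleGraph V}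

/-! ### Convexity in chordal graphs by triangles -/

/-- A set of vertices is triangle closed if it contains every common neighbour of two adjacent
members. -/
def IsTriangleClosed (G : SimpleGraph V) (T : Set V) : Prop :=
  ∀ ⦃a b w⦄, G.Adj a b → G.Adj a w → G.Adj b w → a ∈ T → b ∈ T → w ∈ T

theorem IsCycleConvex.isTriangleClosed {T : Set V} (hT : IsCycleConvex G T) :
    IsTriangleClosed G T := by
  intro a b w hab haw hbw ha hb
  rw [← hT]
  refine Or.inr ⟨.cons haw.symm (.cons hab (.cons hbw .nil)), ?_, ?_⟩
  · have := hab.ne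
    have := haw.ne
    have := hbw.ne
    rw [Walk.cons_isCycle_iff]
    simp [Walk.cons_isPath_iff]
    grind
  · simp [ha, hb]

/-- The vertices of the path `p₁ p₂ p₃` lie in `T` if they do for all shorter paths closing up to
a cycle with an edge inside `T`, and the ends of `p₂` are adjacent. -/
theorem support_append_subset {T : Set V} {a b x y : V} (p₁ : G.Walk a x) (p₂ : G.Walk x y)
    (p₃ : G.Walk y b)
    (ih : ∀ a' b' (q : G.Walk a' b'), q.length < (p₁.append (p₂.append p₃)).length → q.IsPath →
      G.Adj a' b' → s(a', b') ∉ q.edges → a' ∈ T → b' ∈ T → ∀ z ∈ q.support, z ∈ T)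
    (hp : (p₁.append (p₂.append p₃)).IsPath) (hab : G.Adj a b)
    (he : s(a, b) ∉ (p₁.append (p₂.append p₃)).edges) (ha : a ∈ T) (hb : b ∈ T)
    (hxy : G.Adj x y) (hc : s(x, y) ∉ (p₁.append (p₂.append p₃)).edges)
    (hne : s(x, y) ≠ s(a, b)) :
    ∀ z ∈ (p₁.append (p₂.append p₃)).support, z ∈ T := by
  -- The chord is neither an edge of the path nor the closing edge, so both cycles into which it
  -- cuts the original one are strictly shorter.
  have hlen : 2 ≤ p₂.length := by
    cases p₂ with
    | nil => exact absurd hxy (G.loopless.irrefl _)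
    | cons h q =>
      cases q with
      | nil => simp at hc
      | cons => simp
  have hlen' : 1 ≤ p₁.length + p₃.length := by
    by_contra! h
    cases p₁ with
    | nil =>
      cases p₃ with
      | nil => simp at hne
      | cons => simp at h
    | cons => simp at h
  have hq : (p₁.append (.cons hxy p₃)).IsPath := by
    have h1 : p₁.IsPath := hp.of_append_left
    have h3 : p₃.IsPath := hp.of_append_right.of_append_right
    have hdisj : ∀ z ∈ p₁.support, z ∈ p₃.support → False := by
      intro z hz hz3
      rw [Walk.isPath_def, Walk.support_append, List.nodup_append] at hp
      refine hp.2.2 z hz z ?_ rfl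
      have hxp : x ∉ p₂.support.tail := by
        have := hp.2.2 x p₁.end_mem_support x
        intro h
        apply this _ rfl
        rw [Walk.tail_support_append]
        exact List.mem_append_left _ h
      rw [Walk.tail_support_append]
      rw [← Walk.cons_tail_support] at hz3
      rcases List.mem_cons.1 hz3 with rfl | h
      · apply List.mem_append_left
        have := p₂.end_mem_support
        rw [← Walk.cons_tail_support] at this
        rcases List.mem_cons.1 this with h | h
        · exact absurd h hxy.ne'
        · exact h
      · exact List.mem_append_right _ h
    rw [Walk.isPath_def, Walk.support_append, List.nodup_append]
    simp only [Walk.support_cons, List.tail_cons]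
    refine ⟨h1.support_nodup, h3.support_nodup, ?_⟩
    rintro z hz _ hz' rfl
    exact hdisj z hz hz'
  -- The cycle through `ab` comes first: it puts the ends of the chord into `T`, and the chord is
  -- then the edge inside `T` needed for the other cycle.
  have key := ih _ _ (p₁.append (.cons hxy p₃)) (by simp; omega) hq hab (by
    simp only [Walk.edges_append, Walk.edges_cons, List.mem_append, List.mem_cons] at he ⊢
    grind) ha hb
  have hx : x ∈ T := key x (by simp)
  have hy : y ∈ T := key y (by simp)
  have key2 := ih _ _ p₂ (by simp; omega) hp.of_append_right.of_append_left hxy (by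
    simp only [Walk.edges_append, List.mem_append] at hc
    grind) hx hy
  intro z hz
  simp only [Walk.mem_support_append_iff] at hz
  rcases hz with hz | hz | hz
  · exact key z (by simp [hz])
  · exact key2 z hz
  · exact key z (by simp [hz])

theorem IsTriangleClosed.support_subset (hG : IsChordal G) {T : Set V}
    (hT : IsTriangleClosed G T) {a b : V} (p : G.Walk a b) (hp : p.IsPath) (hab : G.Adj a b)
    (he : s(a, b) ∉ p.edges) (ha : a ∈ T) (hb : b ∈ T) : ∀ x ∈ p.support, x ∈ T := by
  induction hn : p.length using Nat.strong_induction_on generalizing a b with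
  | _ n ih =>
  subst hn
  by_cases hl : p.length ≤ 2
  · match p with
    | .nil => simpa using ha
    | .cons h .nil => simp at he
    | .cons h (.cons h' .nil) => simpa [ha, hb] using hT hab h h'.symm ha hb
    | .cons h (.cons h' (.cons h'' q)) => simp at hl
  · have hcyc : (Walk.cons hab.symm p).IsCycle := by
      rw [Walk.cons_isCycle_iff, Sym2.eq_swap]
      exact ⟨hp, he⟩
    obtain ⟨x, hx, y, hy, hxy, hc⟩ := hG _ _ hcyc (by simp; omega)
    have hmem : ∀ z ∈ (Walk.cons hab.symm p).support, z ∈ p.support := by simp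
    replace hx := hmem x hx
    replace hy := hmem y hy
    have hne : s(x, y) ≠ s(a, b) := by
      rintro h
      simp [h, Sym2.eq_swap] at hc
    replace hc : s(x, y) ∉ p.edges := by
      simp at hc
      exact hc.2
    have ih' : ∀ a' b' (q : G.Walk a' b'), q.length < p.length → q.IsPath →
        G.Adj a' b' → s(a', b') ∉ q.edges → a' ∈ T → b' ∈ T → ∀ z ∈ q.support, z ∈ T :=
      fun a' b' q h1 h2 h3 h4 h5 h6 => ih q.length h1 q h2 h3 h4 h5 h6 rfl
    obtain ⟨p₁, p', rfl⟩ := Walk.mem_support_iff_exists_append.1 hx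
    rcases (Walk.mem_support_append_iff _ _).1 hy with hy | hy
    · obtain ⟨p₂, p₃, rfl⟩ := Walk.mem_support_iff_exists_append.1 hy
      simp only [← Walk.append_assoc] at *
      rw [Sym2.eq_swap] at hc hne
      exact support_append_subset p₂ p₃ p' ih' hp hab he ha hb hxy.symm hc hne
    · obtain ⟨p₂, p₃, rfl⟩ := Walk.mem_support_iff_exists_append.1 hy
      exact support_append_subset p₁ p₂ p₃ ih' hp hab he ha hb hxy hc hne

/-- On a cycle `w, x, y, …` inside `T ∪ {w}`, the edge `xy` lies in `T`. The rest of the cycle is a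
path from `y` to `x` through `w`, to which `support_subset` applies. -/
theorem isCycleConvex_iff_isTriangleClosed (hG : IsChordal G) {T : Set V} :
    IsCycleConvex G T ↔ IsTriangleClosed G T := by
  refine ⟨IsCycleConvex.isTriangleClosed, fun hT => ?_⟩
  refine Set.Subset.antisymm ?_ fun w hw => Or.inl hw
  rintro w (hw | ⟨c, hc, hs⟩)
  · exact hw
  · have h3 := hc.three_le_length
    match c with
    | .nil => simp at h3
    | .cons h .nil => exact absurd h (G.loopless.irrefl _)
    | .cons (v := x) h (.cons (v := y) h' q) =>
      have hp := ((Walk.cons_isCycle_iff _ _).1 hc).1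
      have hq := (Walk.cons_isPath_iff _ _).1 hp
      have hxw : x ≠ w := h.ne'
      have hyw : y ≠ w := by
        rintro rfl
        have := hq.1
        rw [Walk.isPath_iff_nil, ← Walk.length_eq_zero_iff] at this
        simp [this] at h3
      have hx : x ∈ T := (hs x (by simp)).resolve_left hxw
      have hy : y ∈ T := (hs y (by simp)).resolve_left hyw
      have hpath : (q.concat h).IsPath := by
        rw [Walk.concat_isPath_iff]
        exact ⟨hq.1, hq.2⟩
      refine hT.support_subset hG (q.concat h) hpath h'.symm ?_ hy hx w (by simp)
      simp only [Walk.edges_concat, List.mem_append, List.mem_singleton, List.concat_eq_append]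
      rintro (h1 | h1)
      · exact hq.2 (Walk.snd_mem_support_of_mem_edges _ h1)
      · simp at h1
        grind

/-! ### Blocks and 2-connected subgraphs -/

theorem exists_adj_boundary {H : G.Subgraph} (hH : H.Preconnected) {D : Set V} {a b : V}
    (ha : a ∈ H.verts) (hb : b ∈ H.verts) (haD : a ∈ D) (hbD : b ∉ D) :
    ∃ x ∈ D, ∃ y ∉ D, H.Adj x y := by
  obtain ⟨p, hp⟩ := (Subgraph.preconnected_iff_forall_exists_walk_subgraph H).1 hH ha hb
  obtain ⟨d, hd, h1, h2⟩ := p.exists_boundary_dart D haD hbD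
  refine ⟨d.fst, h1, d.snd, h2, hp.2 ?_⟩
  rw [← Subgraph.mem_edgeSet, Walk.mem_edges_toSubgraph]
  exact List.mem_map.2 ⟨d, hd, rfl⟩

/-- A triangle closed set containing an edge of a 2-connected subgraph contains the subgraph. -/
theorem IsTriangleClosed.verts_subset (hG : IsChordal G) {T : Set V} (hT : IsTriangleClosed G T)
    {B : G.Subgraph} (hB : IsTwoConnected B) {u v : V} (hu : u ∈ B.verts) (hv : v ∈ B.verts)
    (huv : G.Adj u v) (huT : u ∈ T) (hvT : v ∈ T) : B.verts ⊆ T := by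
  intro w hw
  by_contra hwT
  -- An edge `xy` of `B` leaves the set of vertices having a neighbour in `B ∩ T`, themselves in `B
  -- ∩ T`. Since `B - x` is connected, it joins `y` to `z`, which closes a cycle through the edge
  -- `xz` of `T` and forces `y` into `T`.
  obtain ⟨x, ⟨hxB, hxT, z, hzB, hzT, hxz⟩, y, hyD, hxy⟩ := exists_adj_boundary hB.1.preconnected
    (D := {x | x ∈ B.verts ∧ x ∈ T ∧ ∃ z ∈ B.verts, z ∈ T ∧ G.Adj x z})
    hu hw ⟨hu, huT, v, hv, hvT, huv⟩ (fun h => hwT h.2.1)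
  have hyB : y ∈ B.verts := B.edge_vert hxy.symm
  have hyT : y ∉ T := fun h => hyD ⟨hyB, h, x, hxB, hxT, hxy.adj_sub.symm⟩
  have hyz : y ≠ z := fun h => hyT (h ▸ hzT)
  obtain ⟨p, hp⟩ := (Subgraph.preconnected_iff_forall_exists_walk_subgraph _).1
    (hB.2 x hxB).preconnected (u := y) (v := z)
    (by simp [hyB, hxy.adj_sub.ne']) (by simp [hzB, hxz.ne'])
  classical
  have hxp : x ∉ p.bypass.support := by
    intro h
    have := hp.1 ((Walk.mem_verts_toSubgraph _).2 (p.support_bypass_subset_support h))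
    simp at this
  refine hyT (hT.support_subset hG (.cons hxy.adj_sub p.bypass) ?_ hxz ?_ hxT hzT y (by simp))
  · rw [Walk.cons_isPath_iff]
    exact ⟨p.bypass_isPath, hxp⟩
  · simp only [Walk.edges_cons, List.mem_cons, not_or]
    refine ⟨?_, fun h => hxp (Walk.fst_mem_support_of_mem_edges _ h)⟩
    simp
    grind

theorem IsTwoConnected.exists_ne {B : G.Subgraph} (hB : IsTwoConnected B) (v : V) :
    ∃ u ∈ B.verts, u ≠ v := by
  by_cases hv : v ∈ B.verts
  · obtain ⟨u, hu⟩ := (hB.2 v hv).nonempty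
    exact ⟨u, hu.1, hu.2⟩
  · obtain ⟨u, hu⟩ := hB.1.nonempty
    exact ⟨u, hu, fun h => hv (h ▸ hu)⟩

theorem IsTwoConnected.connected_deleteVerts {B : G.Subgraph} (hB : IsTwoConnected B) (v : V) :
    (B.deleteVerts {v}).Connected := by
  by_cases hv : v ∈ B.verts
  · exact hB.2 v hv
  · refine hB.1.mono' (fun a b h => ?_) (by simp [hv])
    have ha := B.edge_vert h
    have hb := B.edge_vert h.symm
    simp [ha, hb, h]
    grind

theorem IsTwoConnected.mono {H K : G.Subgraph} (hH : IsTwoConnected H) (hle : H ≤ K)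
    (hv : H.verts = K.verts) : IsTwoConnected K :=
  ⟨hH.1.mono hle hv, fun v h => (hH.2 v (hv ▸ h)).mono (Subgraph.deleteVerts_mono hle)
    (by simp [hv])⟩

theorem IsBlock.adj {B : G.Subgraph} (hB : IsBlock G B) {u v : V} (hu : u ∈ B.verts)
    (hv : v ∈ B.verts) (huv : G.Adj u v) : B.Adj u v := by
  have hle : B ≤ (⊤ : G.Subgraph).induce B.verts := Subgraph.le_induce_top_verts
  refine (hB.2 (hB.1.mono hle rfl) hle).2 ?_
  simp [hu, hv, huv]

/-- After the deletion of one vertex, `a` or `b` still joins the two connected remainders. With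
maximality, distinct blocks therefore share at most one vertex. -/
theorem IsTwoConnected.sup {H K : G.Subgraph} (hH : IsTwoConnected H) (hK : IsTwoConnected K)
    {a b : V} (hab : a ≠ b) (ha : a ∈ H.verts) (ha' : a ∈ K.verts) (hb : b ∈ H.verts)
    (hb' : b ∈ K.verts) : IsTwoConnected (H ⊔ K) := by
  refine ⟨Subgraph.connected_sup hH.1.preconnected hK.1.preconnected ⟨a, ha, ha'⟩, fun v _ => ?_⟩
  refine Subgraph.Connected.mono (H := H.deleteVerts {v} ⊔ K.deleteVerts {v}) (sup_le
    (Subgraph.deleteVerts_mono le_sup_left) (Subgraph.deleteVerts_mono le_sup_right))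
    (by ext; simp; tauto) (Subgraph.connected_sup (hH.connected_deleteVerts v).preconnected
      (hK.connected_deleteVerts v).preconnected ?_)
  by_cases h : a = v
  · exact ⟨b, by simp [hb, hb']; grind⟩
  · exact ⟨a, by simp [ha, ha', h]⟩

theorem IsBlock.inter_subsingleton {B C : G.Subgraph} (hB : IsBlock G B) (hC : IsBlock G C)
    (hBC : B ≠ C) : (B.verts ∩ C.verts).Subsingleton := by
  rintro a ⟨ha, ha'⟩ b ⟨hb, hb'⟩
  by_contra hab
  have h := hB.1.sup hC.1 hab ha ha' hb hb'
  have h1 := hB.2 h le_sup_left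
  have h2 := hC.2 h le_sup_right
  exact hBC (le_antisymm (le_sup_left.trans h2) (le_sup_right.trans h1))

theorem isTwoConnected_induce_pair {a b : V} (hab : G.Adj a b) :
    IsTwoConnected ((⊤ : G.Subgraph).induce {a, b}) := by
  refine ⟨Subgraph.top_induce_pair_connected_of_adj hab, fun v hv => ?_⟩
  have key : ∀ a b : V, G.Adj a b →
      (((⊤ : G.Subgraph).induce {a, b}).deleteVerts {a}).Connected := by
    intro a b hab
    refine (Subgraph.singletonSubgraph_connected (G := G) (v := b)).mono' (by simp) ?_
    ext x
    have := hab.ne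
    simp
    grind
  rcases hv with rfl | rfl
  · exact key _ _ hab
  · rw [Set.pair_comm]
    exact key _ _ hab.symm

theorem isTwoConnected_induce_triangle {a b w : V} (hab : G.Adj a b) (haw : G.Adj a w)
    (hbw : G.Adj b w) : IsTwoConnected ((⊤ : G.Subgraph).induce {a, b, w}) := by
  constructor
  · refine (Subgraph.connected_sup (Subgraph.top_induce_pair_connected_of_adj hab).preconnected
      (Subgraph.top_induce_pair_connected_of_adj haw).preconnected ⟨a, by simp⟩).mono
      (sup_le (Subgraph.induce_mono_right (by grind)) (Subgraph.induce_mono_right (by grind))) ?_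
    ext x
    simp
    tauto
  · have key : ∀ a b w : V, G.Adj a b → G.Adj a w → G.Adj b w →
        (((⊤ : G.Subgraph).induce {a, b, w}).deleteVerts {a}).Connected := by
      intro a b w hab haw hbw
      have h1 := hab.ne
      have h2 := haw.ne
      refine (Subgraph.top_induce_pair_connected_of_adj hbw).mono' ?_ ?_
      · simp
        grind
      · ext x
        simp
        grind
    intro v hv
    rcases hv with rfl | rfl | rfl
    · exact key _ _ _ hab haw hbw
    · rw [Set.insert_comm]
      exact key _ _ _ hab.symm hbw haw
    · rw [Set.pair_comm b, Set.insert_comm]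
      exact key _ _ _ haw.symm hbw.symm hab

theorem IsTwoConnected.exists_isBlock [Finite V] {H : G.Subgraph} (hH : IsTwoConnected H) :
    ∃ B, IsBlock G B ∧ H ≤ B := by
  obtain ⟨B, h1, h2⟩ := Finite.exists_le_maximal (p := fun H : G.Subgraph => IsTwoConnected H) hH
  exact ⟨B, h2, h1⟩

theorem IsBlock.exists_ne_ne {B : G.Subgraph} (hB : IsBlock G B)
    (hK : ¬ Nonempty (B.coe ≃g SimpleGraph.completeGraph (Fin 2))) {x y : V} (hx : x ∈ B.verts) :
    ∃ z ∈ B.verts, z ≠ x ∧ z ≠ y := by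
  by_contra! h
  obtain ⟨u, hu, hux⟩ := hB.1.exists_ne x
  have hall : ∀ z ∈ B.verts, z ≠ x → z = y := h
  have huy := hall u hu hux
  subst huy
  have hadj : B.Adj x u := by
    obtain ⟨a, rfl, b, hb, hab⟩ := exists_adj_boundary hB.1.1.preconnected (D := {x}) hx hu rfl hux
    have hb' := hall b (B.edge_vert hab.symm) hb
    exact hb' ▸ hab
  classical
  refine hK ⟨⟨⟨fun z => if z.1 = x then 0 else 1, fun i => if i = 0 then ⟨x, hx⟩ else ⟨u, hu⟩,
    ?_, ?_⟩, ?_⟩⟩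
  · rintro ⟨z, hz⟩
    by_cases hzx : z = x
    · simp [hzx]
    · simp [hall z hz hzx, hux]
  · intro i
    fin_cases i <;> simp [hux]
  · rintro ⟨z, hz⟩ ⟨z', hz'⟩
    by_cases hzx : z = x <;> by_cases hzx' : z' = x
    · simp [hzx, hzx']
    · simp [hzx, hall z' hz' hzx', hadj, hux]
    · simp [hzx', hall z hz hzx, hadj.symm, hux]
    · simp [hall z hz hzx, hall z' hz' hzx']

/-- In a block other than `K₂`, a vertex has a neighbour different from a given vertex. -/
theorem IsBlock.exists_adj_ne {B : G.Subgraph} (hB : IsBlock G B)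
    (hK : ¬ Nonempty (B.coe ≃g SimpleGraph.completeGraph (Fin 2))) {x : V} (hx : x ∈ B.verts)
    (y : V) : ∃ q ∈ B.verts, G.Adj x q ∧ q ≠ y := by
  obtain ⟨z, hz, hzx, hzy⟩ := hB.exists_ne_ne hK (y := y) hx
  by_cases hxy : x = y
  · subst hxy
    obtain ⟨a, rfl, b, hb, hab⟩ :=
      exists_adj_boundary hB.1.1.preconnected (D := {x}) hx hz rfl hzx
    exact ⟨b, B.edge_vert hab.symm, hab.adj_sub, hb⟩
  · obtain ⟨a, rfl, b, hb, hab⟩ :=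
      exists_adj_boundary (hB.1.connected_deleteVerts y).preconnected (D := {x}) (a := x) (b := z)
        (by simp [hx, hxy]) (by simp [hz, hzy]) rfl hzx
    simp only [Subgraph.deleteVerts_adj, Set.mem_singleton_iff] at hab
    exact ⟨b, hab.2.2.1, hab.2.2.2.2.adj_sub, hab.2.2.2.1⟩

/-! ### The chain of blocks -/

/-- `T` contains each set `β j`, `j ∈ J`, two adjacent members of which it contains. -/
def BlockClosed (G : SimpleGraph V) (β : ℕ → Set V) (J : Finset ℕ) (T : Set V) : Prop :=
  ∀ j ∈ J, ∀ u ∈ β j, ∀ v ∈ β j, G.Adj u v → u ∈ T → v ∈ T → β j ⊆ T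

/-- The smallest set containing `S` and closed under the `β j`, `j ∈ J`. -/
inductive Generated (G : SimpleGraph V) (β : ℕ → Set V) (J : Finset ℕ) (S : Set V) : V → Prop
  | base {x : V} (hx : x ∈ S) : Generated G β J S x
  | step {j : ℕ} {u v x : V} (hj : j ∈ J) (hu : u ∈ β j) (hv : v ∈ β j) (huv : G.Adj u v)
      (hx : x ∈ β j) (gu : Generated G β J S u) (gv : Generated G β J S v) : Generated G β J S x

/-- The vertex sets `β 0, …, β (l - 1)` of the blocks of a chordal graph forming a single chain. -/
structure IsBlockChain (G : SimpleGraph V) (l : ℕ) (β : ℕ → Set V) : Prop where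
  convex_iff : ∀ T, IsCycleConvex G T ↔ BlockClosed G β (Finset.range l) T
  eq_empty : ∀ i, l ≤ i → β i = ∅
  inter : ∀ i j, i ≠ j → (β i ∩ β j).Subsingleton
  disjoint : ∀ i j, i + 1 < j → Disjoint (β i) (β j)
  cut : ∀ i, i + 1 < l → ∃ c, IsCutVertex G c ∧ c ∈ β i ∧ c ∈ β (i + 1)
  exists_of_cut : ∀ c, IsCutVertex G c → ∀ i, c ∈ β i → ∃ j, j ≠ i ∧ c ∈ β j
  exists_adj : ∀ i, ∀ x ∈ β i, ∀ y, ∃ q ∈ β i, G.Adj x q ∧ q ≠ y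
  nonempty : ∀ i, i < l → (β i).Nonempty
  cover : 0 < l → ∀ v, ∃ i, v ∈ β i

/-- Every triangle is 2-connected and so lies in a single block; the converse is
`IsTriangleClosed.verts_subset`. -/
theorem blockClosed_iff_isTriangleClosed [Finite V] (hG : IsChordal G) {l : ℕ}
    {B : Fin l → G.Subgraph} (hB : Set.range B = {H | IsBlock G H}) {β : ℕ → Set V}
    (hβ : ∀ i : Fin l, β i = (B i).verts) (T : Set V) :
    IsTriangleClosed G T ↔ BlockClosed G β (Finset.range l) T := by
  have hblock : ∀ i, IsBlock G (B i) := fun i => by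
    have : B i ∈ {H | IsBlock G H} := hB ▸ ⟨i, rfl⟩
    exact this
  constructor
  · intro hT j hj u hu v hv huv huT hvT
    have hj' : β j = (B ⟨j, Finset.mem_range.1 hj⟩).verts := hβ ⟨j, Finset.mem_range.1 hj⟩
    rw [hj'] at hu hv ⊢
    exact hT.verts_subset hG (hblock _).1 hu hv huv huT hvT
  · intro hT a b w hab haw hbw ha hb
    obtain ⟨C, hC, hle⟩ := (isTwoConnected_induce_triangle hab haw hbw).exists_isBlock
    obtain ⟨i, rfl⟩ : C ∈ Set.range B := hB ▸ hC
    have hsub : ∀ x, x = a ∨ x = b ∨ x = w → x ∈ β i := fun x hx => by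
      rw [hβ]
      exact hle.1 hx
    exact hT i (by simp) a (hsub a (by simp)) b (hsub b (by simp)) hab ha hb (hsub w (by simp))

/-- A vertex lying in only one block of a chain is not a cut vertex. -/
theorem induce_compl_preconnected {l : ℕ} {B : Fin l → G.Subgraph}
    (hB : ∀ i, IsBlock G (B i)) (hcover : ∀ v, ∃ i, v ∈ (B i).verts)
    (hcons : ∀ i j : Fin l, (i : ℕ) + 1 = j → ∃ c, c ∈ (B i).verts ∧ c ∈ (B j).verts)
    {c : V} {i : Fin l} (hc : ∀ j, j ≠ i → c ∉ (B j).verts) :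
    (G.induce {c}ᶜ).Preconnected := by
  have hin : ∀ (j : Fin l) (x y : ({c}ᶜ : Set V)), x.1 ∈ (B j).verts → y.1 ∈ (B j).verts →
      (G.induce {c}ᶜ).Reachable x y := by
    intro j x y hx hy
    have h := ((hB j).1.connected_deleteVerts c).coe.preconnected ⟨x, hx, x.2⟩ ⟨y, hy, y.2⟩
    exact h.map (G' := G.induce {c}ᶜ) ⟨fun z => ⟨z.1, z.2.2⟩, fun {a b} hab => by
      have : (B j).Adj a b := by
        have hab' : ((B j).deleteVerts {c}).Adj a b := hab
        simp only [Subgraph.deleteVerts_adj] at hab'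
        exact hab'.2.2.2.2
      exact this.adj_sub⟩
  have hlt : ∀ (n : ℕ) (j k : Fin l) (x y : ({c}ᶜ : Set V)), (j : ℕ) + n = k →
      x.1 ∈ (B j).verts → y.1 ∈ (B k).verts → (G.induce {c}ᶜ).Reachable x y := by
    intro n
    induction n with
    | zero =>
      intro j k x y hjk hx hy
      obtain rfl : j = k := Fin.ext hjk
      exact hin j x y hx hy
    | succ n ih =>
      intro j k x y hjk hx hy
      have hk : (j : ℕ) + n < l := by omega
      obtain ⟨z, hz, hz'⟩ := hcons ⟨j + n, hk⟩ k (by simp; omega)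
      -- `z` lies in two different blocks, whereas `c` lies in none but `B i`.
      have hzc : z ≠ c := by
        rintro rfl
        have h1 : k = i := by
          by_contra h
          exact hc _ h hz'
        have h2 : (⟨j + n, hk⟩ : Fin l) = i := by
          by_contra h
          exact hc _ h hz
        have := h1.trans h2.symm
        simp [Fin.ext_iff] at this
        omega
      exact (ih j ⟨j + n, hk⟩ x ⟨z, hzc⟩ rfl hx hz).trans (hin k ⟨z, hzc⟩ y hz' hy)
  intro x y
  obtain ⟨j, hj⟩ := hcover x
  obtain ⟨k, hk⟩ := hcover y
  rcases le_total (j : ℕ) k with h | h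
  · exact hlt (k - j) j k x y (by omega) hj hk
  · exact (hlt (j - k) k j y x (by omega) hk hj).symm

theorem exists_isBlock_of_connected [Finite V] (hconn : G.Connected) {B : G.Subgraph}
    (hB : IsBlock G B) (v : V) : ∃ C, IsBlock G C ∧ v ∈ C.verts := by
  obtain ⟨u, -, huv⟩ := hB.1.exists_ne v
  have : Nontrivial V := ⟨⟨u, v, huv⟩⟩
  obtain ⟨w, hw⟩ := hconn.preconnected.exists_adj_of_nontrivial v
  obtain ⟨C, hC, hle⟩ := (isTwoConnected_induce_pair hw).exists_isBlock
  exact ⟨C, hC, hle.1 (by simp)⟩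

theorem exists_isBlockChain [Finite V] (hconn : G.Connected) (hG : IsChordal G) {l : ℕ}
    (hchain : BlocksFormSingleChain G l)
    (hK2 : ∀ B : G.Subgraph, IsBlock G B →
      ¬ Nonempty (B.coe ≃g SimpleGraph.completeGraph (Fin 2))) :
    ∃ β : ℕ → Set V, IsBlockChain G l β ∧
      (∀ C : G.Subgraph, IsBlock G C → ∃ i < l, β i = C.verts) ∧
      ∀ i < l, ∃ C : G.Subgraph, IsBlock G C ∧ β i = C.verts := by
  obtain ⟨B, hinj, hB, hcons, hdisj⟩ := hchain
  have hblock : ∀ i, IsBlock G (B i) := fun i => by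
    have : B i ∈ {H | IsBlock G H} := hB ▸ ⟨i, rfl⟩
    exact this
  -- Indices from `l` on get the empty set, so membership in `β i` implies `i < l`.
  let β : ℕ → Set V := fun i => if h : i < l then (B ⟨i, h⟩).verts else ∅
  have hβ : ∀ i : Fin l, β i = (B i).verts := fun i => by simp [β]
  have hmem : ∀ {i x}, x ∈ β i → ∃ h : i < l, x ∈ (B ⟨i, h⟩).verts := by
    intro i x hx
    by_cases h : i < l
    · exact ⟨h, by simpa [β, h] using hx⟩
    · simp [β, h] at hx
  have hcover : 0 < l → ∀ v, ∃ i, v ∈ (B i).verts := by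
    intro h v
    obtain ⟨C, hC, hv⟩ := exists_isBlock_of_connected hconn (hblock ⟨0, h⟩) v
    obtain ⟨i, rfl⟩ : C ∈ Set.range B := hB ▸ hC
    exact ⟨i, hv⟩
  refine ⟨β, ⟨fun T => ?_, fun i hi => ?_, fun i j hij => ?_, fun i j hij => ?_, fun i hi => ?_,
    fun c hc i hi => ?_, fun i x hx y => ?_, fun i hi => ?_, fun h v => ?_⟩, fun C hC => ?_,
    fun i hi => ⟨B ⟨i, hi⟩, hblock _, hβ ⟨i, hi⟩⟩⟩
  · rw [isCycleConvex_iff_isTriangleClosed hG, blockClosed_iff_isTriangleClosed hG hB hβ]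
  · simp [β, hi]
  · rintro x ⟨hx, hx'⟩ y ⟨hy, hy'⟩
    obtain ⟨hi, hx⟩ := hmem hx
    obtain ⟨hj, hx'⟩ := hmem hx'
    obtain ⟨_, hy⟩ := hmem hy
    obtain ⟨_, hy'⟩ := hmem hy'
    refine (hblock ⟨i, hi⟩).inter_subsingleton (hblock ⟨j, hj⟩) (fun h => hij ?_) ⟨hx, hx'⟩
      ⟨hy, hy'⟩
    simpa using hinj h
  · rw [Set.disjoint_left]
    intro x hx hx'
    obtain ⟨hi, hx⟩ := hmem hx
    obtain ⟨hj, hx'⟩ := hmem hx'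
    exact Set.disjoint_left.1 (hdisj ⟨i, hi⟩ ⟨j, hj⟩ hij) hx hx'
  · obtain ⟨c, hc, h1, h2⟩ := hcons ⟨i, by omega⟩ ⟨i + 1, hi⟩ rfl
    exact ⟨c, hc, by rwa [← hβ] at h1, by rwa [← hβ] at h2⟩
  · by_contra! h
    obtain ⟨hi', -⟩ := hmem hi
    refine hc (induce_compl_preconnected hblock (hcover (by omega)) (fun i j hij => ?_)
      (i := ⟨i, hi'⟩) fun j hj hcj => ?_)
    · obtain ⟨c, -, h⟩ := hcons i j hij
      exact ⟨c, h⟩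
    · refine h j (fun h => hj (Fin.ext h)) ?_
      rwa [hβ]
  · obtain ⟨hi, hx⟩ := hmem hx
    obtain ⟨q, hq, h⟩ := (hblock ⟨i, hi⟩).exists_adj_ne (hK2 _ (hblock ⟨i, hi⟩)) hx y
    exact ⟨q, by rwa [← hβ] at hq, h⟩
  · have := (hblock ⟨i, hi⟩).1.1.nonempty
    rwa [← hβ] at this
  · obtain ⟨i, hi⟩ := hcover h v
    exact ⟨i, by rwa [hβ]⟩
  · obtain ⟨i, rfl⟩ : C ∈ Set.range B := hB ▸ hC
    exact ⟨i, i.2, hβ i⟩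

/-! ### Generation by blocks and the upper bounds -/

variable {β : ℕ → Set V}

theorem Generated.mono {J J' : Finset ℕ} {S S' : Set V} (hJ : J ⊆ J') (hS : S ⊆ S') {x : V}
    (h : Generated G β J S x) : Generated G β J' S' x := by
  induction h with
  | base hx => exact .base (hS hx)
  | step hj hu hv huv hx _ _ ihu ihv => exact .step (hJ hj) hu hv huv hx ihu ihv

theorem Generated.mem_of_blockClosed {J : Finset ℕ} {S T : Set V} (hT : BlockClosed G β J T)
    (hS : S ⊆ T) {x : V} (h : Generated G β J S x) : x ∈ T := by
  induction h with
  | base hx => exact hS hx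
  | step hj hu hv huv hx _ _ ihu ihv => exact hT _ hj _ hu _ hv huv ihu ihv hx

theorem Generated.mem_or_exists {J : Finset ℕ} {S : Set V} {x : V} (h : Generated G β J S x) :
    x ∈ S ∨ ∃ j ∈ J, x ∈ β j := by
  cases h with
  | base hx => exact Or.inl hx
  | step hj hu hv huv hx => exact Or.inr ⟨_, hj, hx⟩

theorem IsBlockChain.mem_cycleHull_iff {l : ℕ} (hβ : IsBlockChain G l β) {S : Set V} {x : V} :
    x ∈ cycleHull G S ↔ Generated G β (Finset.range l) S x := by
  constructor
  · intro h
    refine cycleHull_subset G (T := {x | Generated G β (Finset.range l) S x})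
      ((hβ.convex_iff _).2 ?_) (fun y hy => .base hy) h
    intro j hj u hu v hv huv hgu hgv y hy
    exact Generated.step hj hu hv huv hy hgu hgv
  · intro h
    exact h.mem_of_blockClosed ((hβ.convex_iff _).1 (isCycleConvex_cycleHull G S))
      (subset_cycleHull G S)

/-- Blocks on different sides of `r` are not consecutive, hence disjoint, so a derivation that never
fires `β r` cannot use both sides: a vertex of one side obtained from the other already belongs to
`S`. -/
theorem IsBlockChain.generated_sdiff {l : ℕ} (hβ : IsBlockChain G l β) {J : Finset ℕ} {r : ℕ}
    {S : Set V} {x : V} (h : Generated G β (J.erase r) S x) :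
    Generated G β (J.filter (· < r)) S x ∨ Generated G β (J.filter (r < ·)) S x := by
  induction h with
  | base hx => exact Or.inl (.base hx)
  | @step j u v x hj hu hv huv hx _ _ ihu ihv =>
    obtain ⟨hjr, hj⟩ := Finset.mem_erase.1 hj
    rcases lt_or_gt_of_ne hjr with hlt | hlt
    · have key : ∀ y ∈ β j, Generated G β (J.filter (r < ·)) S y →
          Generated G β (J.filter (· < r)) S y := by
        intro y hy h
        rcases h.mem_or_exists with h | ⟨i, hi, hyi⟩
        · exact .base h
        · have hi := (Finset.mem_filter.1 hi).2
          exact absurd hyi (Set.disjoint_left.1 (hβ.disjoint j i (by omega)) hy)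
      exact Or.inl (.step (by simp [hj, hlt]) hu hv huv hx (ihu.elim id (key u hu))
        (ihv.elim id (key v hv)))
    · have key : ∀ y ∈ β j, Generated G β (J.filter (· < r)) S y →
          Generated G β (J.filter (r < ·)) S y := by
        intro y hy h
        rcases h.mem_or_exists with h | ⟨i, hi, hyi⟩
        · exact .base h
        · have hi := (Finset.mem_filter.1 hi).2
          exact absurd hy (Set.disjoint_left.1 (hβ.disjoint i j (by omega)) hyi)
      exact Or.inr (.step (by simp [hj, hlt]) hu hv huv hx (ihu.elim (key u hu) id)
        (ihv.elim (key v hv) id))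

theorem generated_erase_of_forall {J : Finset ℕ} {r : ℕ} {S : Set V}
    (h : ∀ u ∈ β r, ∀ v ∈ β r, G.Adj u v → Generated G β (J.erase r) S u →
      ¬ Generated G β (J.erase r) S v) {x : V}
    (hx : Generated G β J S x) : Generated G β (J.erase r) S x := by
  refine hx.mem_of_blockClosed (T := {x | Generated G β (J.erase r) S x}) ?_ fun y hy => .base hy
  intro j hj u hu v hv huv hgu hgv y hy
  by_cases hjr : j = r
  · subst hjr
    exact absurd hgv (h u hu v hv huv hgu)
  · exact Generated.step (Finset.mem_erase.2 ⟨hjr, hj⟩) hu hv huv hy hgu hgv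

/-- A generated vertex is generated with fewer sets, or a set `β r` containing it has an edge whose
ends are generated from the two sides of `r`. -/
theorem IsBlockChain.generated_cases {l : ℕ} (hβ : IsBlockChain G l β) {J : Finset ℕ} {S : Set V}
    {t : V} (h : Generated G β J S t) (htS : t ∉ S) :
    (∃ j ∈ J, Generated G β (J.erase j) S t) ∨
    ∃ r ∈ J, ∃ u ∈ β r, ∃ v ∈ β r, t ∈ β r ∧ G.Adj u v ∧
      Generated G β (J.filter (· < r)) S u ∧ Generated G β (J.filter (r < ·)) S v := by
  by_cases hdrop : ∃ j ∈ J, Generated G β (J.erase j) S t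
  · exact Or.inl hdrop
  · push Not at hdrop
    right
    obtain ⟨r, hr, htr⟩ := h.mem_or_exists.resolve_left htS
    have hact : ∃ u ∈ β r, ∃ v ∈ β r, G.Adj u v ∧ Generated G β (J.erase r) S u ∧
        Generated G β (J.erase r) S v := by
      by_contra! hno
      exact hdrop r hr (generated_erase_of_forall hno h)
    obtain ⟨u, hu, v, hv, huv, hgu, hgv⟩ := hact
    refine ⟨r, hr, ?_⟩
    -- If both ends come from the same side, one of them lies in `S` and may be assigned to the
    -- other side. Otherwise both lie in the block next to `β r`, which shares at most one vertex
    -- with `β r`.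
    rcases hβ.generated_sdiff hgu with hu' | hu' <;> rcases hβ.generated_sdiff hgv with hv' | hv'
    · rcases hu'.mem_or_exists with h1 | ⟨i, hi, hui⟩
      · exact ⟨v, hv, u, hu, htr, huv.symm, hv', .base h1⟩
      · rcases hv'.mem_or_exists with h2 | ⟨j, hj, hvj⟩
        · exact ⟨u, hu, v, hv, htr, huv, hu', .base h2⟩
        · have hi := (Finset.mem_filter.1 hi).2
          have hj := (Finset.mem_filter.1 hj).2
          have h1 : i + 1 = r := by
            by_contra hne
            exact Set.disjoint_left.1 (hβ.disjoint i r (by omega)) hui hu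
          have h2 : j + 1 = r := by
            by_contra hne
            exact Set.disjoint_left.1 (hβ.disjoint j r (by omega)) hvj hv
          obtain rfl : i = j := by omega
          exact absurd (hβ.inter i r (by omega) ⟨hui, hu⟩ ⟨hvj, hv⟩) huv.ne
    · exact ⟨u, hu, v, hv, htr, huv, hu', hv'⟩
    · exact ⟨v, hv, u, hu, htr, huv.symm, hv', hu'⟩
    · rcases hu'.mem_or_exists with h1 | ⟨i, hi, hui⟩
      · exact ⟨u, hu, v, hv, htr, huv, .base h1, hv'⟩
      · rcases hv'.mem_or_exists with h2 | ⟨j, hj, hvj⟩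
        · exact ⟨v, hv, u, hu, htr, huv.symm, .base h2, hu'⟩
        · have hi := (Finset.mem_filter.1 hi).2
          have hj := (Finset.mem_filter.1 hj).2
          have h1 : r + 1 = i := by
            by_contra hne
            exact Set.disjoint_left.1 (hβ.disjoint r i (by omega)) hu hui
          have h2 : r + 1 = j := by
            by_contra hne
            exact Set.disjoint_left.1 (hβ.disjoint r j (by omega)) hv hvj
          obtain rfl : i = j := by omega
          exact absurd (hβ.inter i r (by omega) ⟨hui, hu⟩ ⟨hvj, hv⟩) huv.ne

theorem card_filter_lt_add_card_filter_gt {J : Finset ℕ} {r : ℕ} (hr : r ∈ J) :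
    (J.filter (· < r)).card + (J.filter (r < ·)).card + 1 = J.card := by
  rw [← Finset.card_union_of_disjoint, ← Finset.card_erase_add_one hr]
  · congr 2
    ext x
    simp
    grind
  · rw [Finset.disjoint_left]
    intro x hx hx'
    have := (Finset.mem_filter.1 hx).2
    have := (Finset.mem_filter.1 hx').2
    omega

/-- A generated vertex is generated by at most one vertex more than there are sets. -/
theorem IsBlockChain.exists_finset_generated {l : ℕ} (hβ : IsBlockChain G l β) {J : Finset ℕ}
    {S : Set V} {t : V} (h : Generated G β J S t) :
    ∃ F : Finset V, (F : Set V) ⊆ S ∧ F.card ≤ J.card + 1 ∧ Generated G β J F t := by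
  classical
  induction hn : J.card using Nat.strong_induction_on generalizing J t with
  | _ n ih =>
  subst hn
  by_cases htS : t ∈ S
  · exact ⟨{t}, by simpa using htS, by simp, .base (by simp)⟩
  rcases hβ.generated_cases h htS with ⟨j, hj, h⟩ | ⟨r, hr, u, hu, v, hv, htr, huv, hgu, hgv⟩
  · have hlt := Finset.card_erase_lt_of_mem hj
    obtain ⟨F, h1, h2, h3⟩ := ih _ hlt h rfl
    exact ⟨F, h1, by omega, h3.mono (Finset.erase_subset _ _) le_rfl⟩
  -- The two sides contain `|J| - 1` blocks altogether, so the two inductive bounds add up to `|J| +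
  -- 1`.
  · have hcard := card_filter_lt_add_card_filter_gt hr
    obtain ⟨F₁, h1, h2, h3⟩ := ih _ (by omega) hgu rfl
    obtain ⟨F₂, h1', h2', h3'⟩ := ih _ (by omega) hgv rfl
    have := Finset.card_union_le F₁ F₂
    refine ⟨F₁ ∪ F₂, by simp [h1, h1'], by omega, .step hr hu hv huv htr
      (h3.mono (Finset.filter_subset _ _) (by simp)) (h3'.mono (Finset.filter_subset _ _) (by simp))⟩

/-- Without an edge of some `β r` at distance at least two from `p`, adding `p` saves a vertex. -/
theorem IsBlockChain.exists_finset_generated_insert {l : ℕ} (hβ : IsBlockChain G l β) {p : V}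
    (hp : ∀ r, p ∈ β r → ∀ u ∈ β r, ∀ v ∈ β r, G.Adj u v → u ≠ p → v ≠ p → ¬ G.Adj u p →
      G.Adj v p) {J : Finset ℕ} {S : Set V} {t : V} (hpJ : ∃ j ∈ J, p ∈ β j)
    (h : Generated G β J S t) :
    ∃ F : Finset V, (F : Set V) ⊆ S ∧ F.card ≤ J.card ∧ Generated G β J (insert p F) t := by
  classical
  induction hn : J.card using Nat.strong_induction_on generalizing J t with
  | _ n ih =>
  subst hn
  obtain ⟨j, hj, hpj⟩ := hpJ
  have hpos := Finset.card_pos.2 ⟨j, hj⟩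
  by_cases htS : t ∈ S
  · exact ⟨{t}, by simpa using htS, by rwa [Finset.card_singleton], .base (by simp)⟩
  rcases hβ.generated_cases h htS with ⟨j, hj, h⟩ | ⟨r, hr, u, hu, v, hv, htr, huv, hgu, hgv⟩
  -- A block has been dropped, so the general bound suffices, even if no remaining block contains
  -- `p`.
  · have hlt := Finset.card_erase_lt_of_mem hj
    obtain ⟨F, h1, h2, h3⟩ := hβ.exists_finset_generated h
    exact ⟨F, h1, by omega, h3.mono (Finset.erase_subset _ _) (Set.subset_insert _ _)⟩
  · have hcard := card_filter_lt_add_card_filter_gt hr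
    obtain ⟨F₁, h1, h2, h3⟩ := hβ.exists_finset_generated hgu
    obtain ⟨F₂, h1', h2', h3'⟩ := hβ.exists_finset_generated hgv
    rcases lt_trichotomy j r with hjr | rfl | hjr
    · obtain ⟨F, k1, k2, k3⟩ := ih _ (by omega) ⟨j, by simp [hj, hjr], hpj⟩ hgu rfl
      have := Finset.card_union_le F F₂
      exact ⟨F ∪ F₂, by simp [k1, h1'], by omega, .step hr hu hv huv htr
        (k3.mono (Finset.filter_subset _ _) (by grind))
        (h3'.mono (Finset.filter_subset _ _) (by grind))⟩
    -- Here `p` lies in the firing block itself and forms an edge with `u` or `v`; the branch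
    -- generating the other end is dispensable.
    · by_cases hup : u = p ∨ G.Adj v p
      · have hpv : G.Adj p v := hup.elim (fun h => h ▸ huv) fun h => h.symm
        exact ⟨F₂, h1', by omega, .step hr hpj hv hpv htr (.base (by simp))
          (h3'.mono (Finset.filter_subset _ _) (by simp))⟩
      · have hvp : v = p ∨ G.Adj u p := by
          by_contra! hcon
          exact hup (Or.inr (hp j hpj u hu v hv huv (fun h => hup (Or.inl h)) hcon.1 hcon.2))
        have hpu : G.Adj u p := hvp.elim (fun h => h ▸ huv) id
        exact ⟨F₁, h1, by omega, .step hr hu hpj hpu htr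
          (h3.mono (Finset.filter_subset _ _) (by simp)) (.base (by simp))⟩
    · obtain ⟨F, k1, k2, k3⟩ := ih _ (by omega) ⟨j, by simp [hj, hjr], hpj⟩ hgv rfl
      have := Finset.card_union_le F₁ F
      exact ⟨F₁ ∪ F, by simp [k1, h1], by omega, .step hr hu hv huv htr
        (h3.mono (Finset.filter_subset _ _) (by grind))
        (k3.mono (Finset.filter_subset _ _) (by grind))⟩

theorem IsExchangeIndependent.exists_pivot {S : Finset V} (hS : IsExchangeIndependent G S) :
    S.card = 1 ∨ ∃ p ∈ S, ∃ t ∈ cycleHull G ((S : Set V) \ {p}), ∀ a ∈ S, a ≠ p →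
      t ∉ cycleHull G ((S : Set V) \ {a}) := by
  refine hS.2.imp id fun ⟨p, hp, h⟩ => ⟨p, hp, ?_⟩
  obtain ⟨t, ht, ht'⟩ := Set.not_subset.1 h
  refine ⟨t, ht, fun a ha hap hta => ht' ?_⟩
  simp only [Set.mem_iUnion]
  exact ⟨a, ⟨ha, hap⟩, hta⟩

/-- At most `l + 1` vertices of `S \ {p}` generate the uncovered vertex `t`. Any further `a` in `S \
{p}` would leave `t` in the hull of `S \ {a}`. -/
theorem IsBlockChain.card_le {l : ℕ} (hβ : IsBlockChain G l β) {S : Finset V}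
    (hS : IsExchangeIndependent G S) : S.card ≤ l + 2 := by
  classical
  rcases hS.exists_pivot with h | ⟨p, hp, t, ht, ht'⟩
  · omega
  by_contra! hcard
  obtain ⟨F, h1, h2, h3⟩ := hβ.exists_finset_generated (hβ.mem_cycleHull_iff.1 ht)
  rw [Finset.card_range] at h2
  have := Finset.card_erase_add_one hp
  obtain ⟨a, ha, haF⟩ := Finset.exists_mem_notMem_of_card_lt_card
    (show F.card < (S.erase p).card by omega)
  obtain ⟨hap, haS⟩ := Finset.mem_erase.1 ha
  refine ht' a haS hap (hβ.mem_cycleHull_iff.2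
    (h3.mono (S' := (S : Set V) \ {a}) le_rfl fun x hx => ⟨(h1 hx).1, ?_⟩))
  rintro rfl
  exact haF hx

theorem IsBlockChain.card_le_of_forall {l : ℕ} (hβ : IsBlockChain G l β) (hl : 0 < l)
    (h : ∀ r, ∀ p ∈ β r, ∀ u ∈ β r, ∀ v ∈ β r, G.Adj u v → u ≠ p → v ≠ p → ¬ G.Adj u p →
      G.Adj v p) {S : Finset V}
    (hS : IsExchangeIndependent G S) : S.card ≤ l + 1 := by
  classical
  rcases hS.exists_pivot with h | ⟨p, hp, t, ht, ht'⟩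
  · omega
  by_contra! hcard
  obtain ⟨j, hj⟩ := hβ.cover hl p
  have hjl : j < l := by
    by_contra! h
    simp [hβ.eq_empty j h] at hj
  obtain ⟨F, h1, h2, h3⟩ := hβ.exists_finset_generated_insert (p := p) (fun r hr => h r p hr)
    (J := Finset.range l) ⟨j, Finset.mem_range.2 hjl, hj⟩ (hβ.mem_cycleHull_iff.1 ht)
  rw [Finset.card_range] at h2
  have := Finset.card_erase_add_one hp
  obtain ⟨a, ha, haF⟩ := Finset.exists_mem_notMem_of_card_lt_card
    (show F.card < (S.erase p).card by omega)
  obtain ⟨hap, haS⟩ := Finset.mem_erase.1 ha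
  refine ht' a haS hap (hβ.mem_cycleHull_iff.2 
    (h3.mono (S' := (S : Set V) \ {a}) le_rfl fun x hx => ?_))
  rcases hx with rfl | hx
  · exact ⟨hp, Ne.symm hap⟩
  · refine ⟨(h1 hx).1, ?_⟩
    rintro rfl
    exact haF hx

/-! ### Reversal of the chain and linkings -/

variable {l : ℕ} {d : ℕ → V}

theorem IsBlockChain.lt_of_mem (hβ : IsBlockChain G l β) {i : ℕ} {x : V} (hx : x ∈ β i) :
    i < l := by
  by_contra! h
  simp [hβ.eq_empty i h] at hx

theorem IsBlockChain.eq_add_one_or (hβ : IsBlockChain G l β) {i j : ℕ} {x : V} (hi : x ∈ β i)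
    (hj : x ∈ β j) (hij : i ≠ j) : j = i + 1 ∨ i = j + 1 := by
  by_contra! h
  rcases lt_or_gt_of_ne hij with hlt | hlt
  · exact Set.disjoint_left.1 (hβ.disjoint i j (by omega)) hi hj
  · exact Set.disjoint_left.1 (hβ.disjoint j i (by omega)) hj hi

theorem IsBlockChain.isCutVertex (hβ : IsBlockChain G l β) {i j : ℕ} {x : V} (hi : x ∈ β i)
    (hj : x ∈ β j) (hij : i ≠ j) : IsCutVertex G x := by
  have key : ∀ i, x ∈ β i → x ∈ β (i + 1) → IsCutVertex G x := by
    intro i hi hi'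
    obtain ⟨c, hc, h1, h2⟩ := hβ.cut i (hβ.lt_of_mem hi')
    exact hβ.inter i (i + 1) (by omega) ⟨h1, h2⟩ ⟨hi, hi'⟩ ▸ hc
  rcases hβ.eq_add_one_or hi hj hij with rfl | rfl
  · exact key _ hi hj
  · exact key _ hj hi

/-- The sets `β 0, …, β (l - 1)` in reverse order. -/
def reverseChain (l : ℕ) (β : ℕ → Set V) (i : ℕ) : Set V :=
  {x | i < l ∧ x ∈ β (l - 1 - i)}

theorem blockClosed_reverseChain {T : Set V} :
    BlockClosed G (reverseChain l β) (Finset.range l) T ↔ BlockClosed G β (Finset.range l) T := by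
  constructor
  · intro h j hj u hu v hv huv huT hvT x hx
    have hj := Finset.mem_range.1 hj
    have e : l - 1 - (l - 1 - j) = j := by omega
    exact h (l - 1 - j) (Finset.mem_range.2 (by omega)) u ⟨by omega, by rwa [e]⟩ v
      ⟨by omega, by rwa [e]⟩ huv huT hvT ⟨by omega, by rwa [e]⟩
  · intro h j hj u hu v hv huv huT hvT x hx
    have hj := Finset.mem_range.1 hj
    exact h (l - 1 - j) (Finset.mem_range.2 (by omega)) u hu.2 v hv.2 huv huT hvT hx.2

theorem Generated.of_reverseChain {J : Finset ℕ} {S : Set V} {x : V}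
    (h : Generated G (reverseChain l β) J S x) : Generated G β (Finset.range l) S x := by
  induction h with
  | base hx => exact .base hx
  | step hj hu hv huv hx _ _ ihu ihv =>
    exact .step (Finset.mem_range.2 (by have := hu.1; omega)) hu.2 hv.2 huv hx.2 ihu ihv

theorem IsBlockChain.reverse (hβ : IsBlockChain G l β) : IsBlockChain G l (reverseChain l β) where
  convex_iff T := by rw [hβ.convex_iff, blockClosed_reverseChain]
  eq_empty i hi := Set.eq_empty_of_forall_notMem fun x hx => by
    have := hx.1
    omega
  inter i j hij := by
    rintro x ⟨hx, hx'⟩ y ⟨hy, hy'⟩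
    have := hx.1
    have := hx'.1
    exact hβ.inter (l - 1 - i) (l - 1 - j) (by omega) ⟨hx.2, hx'.2⟩ ⟨hy.2, hy'.2⟩
  disjoint i j hij := by
    rw [Set.disjoint_left]
    intro x hx hx'
    have := hx.1
    have := hx'.1
    exact Set.disjoint_left.1 (hβ.disjoint (l - 1 - j) (l - 1 - i) (by omega)) hx'.2 hx.2
  cut i hi := by
    obtain ⟨c, hc, h1, h2⟩ := hβ.cut (l - 1 - (i + 1)) (by omega)
    rw [show l - 1 - (i + 1) + 1 = l - 1 - i by omega] at h2
    exact ⟨c, hc, ⟨by omega, h2⟩, ⟨by omega, h1⟩⟩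
  exists_of_cut c hc i hi := by
    obtain ⟨j, hj, hcj⟩ := hβ.exists_of_cut c hc _ hi.2
    have := hβ.lt_of_mem hcj
    have := hi.1
    exact ⟨l - 1 - j, by omega, by omega, by rwa [show l - 1 - (l - 1 - j) = j by omega]⟩
  exists_adj i x hx y := by
    obtain ⟨q, hq, h⟩ := hβ.exists_adj _ x hx.2 y
    exact ⟨q, ⟨hx.1, hq⟩, h⟩
  nonempty i hi := by
    obtain ⟨x, hx⟩ := hβ.nonempty (l - 1 - i) (by omega)
    exact ⟨x, hi, hx⟩
  cover hl v := by
    obtain ⟨i, hi⟩ := hβ.cover hl v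
    have := hβ.lt_of_mem hi
    exact ⟨l - 1 - i, by omega, by rwa [show l - 1 - (l - 1 - i) = i by omega]⟩

/-- Consecutive members of the sequence `d 0, …, d l` are distinct vertices of `β i`. -/
structure IsLinking (l : ℕ) (β : ℕ → Set V) (d : ℕ → V) : Prop where
  left : ∀ i < l, d i ∈ β i
  right : ∀ i < l, d (i + 1) ∈ β i
  ne : ∀ i < l, d i ≠ d (i + 1)

theorem IsLinking.reverse (hd : IsLinking l β d) :
    IsLinking l (reverseChain l β) (fun i => d (l - i)) where
  left i hi := ⟨hi, by
    have := hd.right (l - 1 - i) (by omega)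
    rwa [show l - 1 - i + 1 = l - i by omega] at this⟩
  right i hi := ⟨hi, by
    have := hd.left (l - 1 - i) (by omega)
    rwa [show l - 1 - i = l - (i + 1) by omega] at this ⊢⟩
  ne i hi := by
    have := hd.ne (l - (i + 1)) (by omega)
    rw [show l - (i + 1) + 1 = l - i by omega] at this
    exact this.symm

/-- A vertex of the first block and a vertex of the last block extend to a linking. -/
theorem IsBlockChain.exists_isLinking (hβ : IsBlockChain G l β) {a b : V} (ha : a ∈ β 0)
    (ha' : ∀ j, j ≠ 0 → a ∉ β j) (hb : b ∈ β (l - 1)) (hb' : ∀ j, j ≠ l - 1 → b ∉ β j)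
    (hab : l = 1 → a ≠ b) : ∃ d, IsLinking l β d ∧ d 0 = a ∧ d l = b := by
  have hl := hβ.lt_of_mem ha
  have : Nonempty V := ⟨a⟩
  choose! c hc using hβ.cut
  -- The vertex `c i` is shared by `β i` and `β (i + 1)`, so it takes position `i + 1` of the
  -- linking.
  refine ⟨fun i => if i = 0 then a else if i < l then c (i - 1) else b, ⟨fun i hi => ?_,
    fun i hi => ?_, fun i hi => ?_⟩, by simp, by simp; omega⟩
  · rcases Nat.eq_zero_or_pos i with rfl | h
    · simpa
    · obtain ⟨k, rfl⟩ := Nat.exists_eq_add_of_lt h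
      rw [zero_add] at hi
      simpa [hi] using (hc k hi).2.2
  · by_cases h : i + 1 < l
    · simpa [h] using (hc i h).2.1
    · obtain rfl : i = l - 1 := by omega
      simpa [h] using hb
  · by_cases h : i + 1 < l
    · rcases Nat.eq_zero_or_pos i with rfl | h'
      · simp only [↓reduceIte, h]
        intro he
        exact ha' 1 (by simp) (by rw [he]; exact (hc 0 h).2.2)
      · obtain ⟨k, rfl⟩ := Nat.exists_eq_add_of_lt h'
        have h1 := (hc k (by omega)).2.1
        have h2 := (hc (k + 1) (by omega)).2.2
        simp only [zero_add] at *
        simp [hi, h]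
        intro he
        exact Set.disjoint_left.1 (hβ.disjoint k (k + 1 + 1) (by omega)) h1 (by rwa [he])
    · obtain rfl : i = l - 1 := by omega
      rcases Nat.eq_zero_or_pos (l - 1) with h' | h'
      · simpa [h', show l = 1 by omega] using hab (by omega)
      · have h1 := (hc (l - 1 - 1) (by omega)).2.1
        simp [h, hi, show l - 1 ≠ 0 by omega]
        intro he
        exact hb' (l - 1 - 1) (by omega) (by rwa [← he])

/-- If `β i` meets the other blocks in one vertex only, every neighbour of that vertex in `β i` is
private, and one of them differs from `z`. -/
theorem IsBlockChain.exists_mem_only (hβ : IsBlockChain G l β) {i : ℕ} (hi : i < l)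
    (h : ∀ j k, j ≠ i → k ≠ i → ∀ x ∈ β i, x ∈ β j → ∀ y ∈ β i, y ∈ β k → x = y) (z : V) :
    ∃ x ∈ β i, x ≠ z ∧ ∀ j, j ≠ i → x ∉ β j := by
  by_cases hc : ∃ c ∈ β i, ∃ j, j ≠ i ∧ c ∈ β j
  · obtain ⟨c, hci, j, hj, hcj⟩ := hc
    obtain ⟨q, hq, hcq, hqz⟩ := hβ.exists_adj i c hci z
    exact ⟨q, hq, hqz, fun k hk hqk => hcq.ne (h j k hj hk c hci hcj q hq hqk)⟩
  · push Not at hc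
    obtain ⟨x, hx⟩ := hβ.nonempty i hi
    obtain ⟨q, hq, -, hqz⟩ := hβ.exists_adj i x hx z
    exact ⟨q, hq, hqz, hc q hq⟩

theorem IsBlockChain.exists_mem_last (hβ : IsBlockChain G l β) (hl : 0 < l) (z : V) :
    ∃ x ∈ β (l - 1), x ≠ z ∧ ∀ j, j ≠ l - 1 → x ∉ β j := by
  refine hβ.exists_mem_only (by omega) (fun j k hj hk x hx hxj y hy hyk => ?_) z
  have h1 := hβ.eq_add_one_or hx hxj hj.symm
  have h2 := hβ.eq_add_one_or hy hyk hk.symm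
  have h3 := hβ.lt_of_mem hxj
  have h4 := hβ.lt_of_mem hyk
  obtain rfl : j = k := by omega
  exact hβ.inter _ _ hj ⟨hxj, hx⟩ ⟨hyk, hy⟩

theorem IsBlockChain.exists_mem_first (hβ : IsBlockChain G l β) (hl : 0 < l) (z : V) :
    ∃ x ∈ β 0, x ≠ z ∧ ∀ j, j ≠ 0 → x ∉ β j := by
  refine hβ.exists_mem_only hl (fun j k hj hk x hx hxj y hy hyk => ?_) z
  have h1 := hβ.eq_add_one_or hx hxj hj.symm
  have h2 := hβ.eq_add_one_or hy hyk hk.symm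
  obtain rfl : j = k := by omega
  exact hβ.inter _ _ hj ⟨hxj, hx⟩ ⟨hyk, hy⟩

/-! ### Critical chains -/

/-- The first vertex of a linking together with the sets `β j`, `j < i`. -/
def initialPart (β : ℕ → Set V) (d : ℕ → V) (i : ℕ) : Set V :=
  {x | x = d 0 ∨ ∃ j < i, x ∈ β j}

theorem IsLinking.exists_of_mem_initialPart (hd : IsLinking l β d) {i : ℕ} (hi : i < l) {x : V}
    (hx : x ∈ initialPart β d i) : x = d i ∨ ∃ j < i, x ∈ β j := by
  rcases hx with rfl | h
  · rcases Nat.eq_zero_or_pos i with rfl | h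
    · exact Or.inl rfl
    · exact Or.inr ⟨0, h, hd.left 0 (by omega)⟩
  · exact Or.inr h

/-- The part of the chain before `β i` is attached to it at `d i` alone. -/
theorem IsLinking.eq_of_mem (hd : IsLinking l β d) (hβ : IsBlockChain G l β) {i : ℕ} {x : V}
    (hx : x ∈ initialPart β d i) (hxi : x ∈ β i) : x = d i := by
  have hi := hβ.lt_of_mem hxi
  rcases hd.exists_of_mem_initialPart hi hx with rfl | ⟨j, hj, hxj⟩
  · rfl
  · have := hβ.eq_add_one_or hxj hxi (by omega)
    obtain rfl : i = j + 1 := by omega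
    exact hβ.inter _ _ (by omega) ⟨hxj, hxi⟩ ⟨hd.right j (by omega), hd.left _ hi⟩

theorem IsLinking.notMem_initialPart (hd : IsLinking l β d) (hβ : IsBlockChain G l β) {i : ℕ}
    (hi : i < l) : d (i + 1) ∉ initialPart β d i := fun h =>
  hd.ne i hi (hd.eq_of_mem hβ h (hd.right i hi)).symm

theorem initialPart_mono {i j : ℕ} (hij : i ≤ j) : initialPart β d i ⊆ initialPart β d j := by
  rintro x (h | ⟨k, hk, h⟩)
  · exact Or.inl h
  · exact Or.inr ⟨k, by omega, h⟩

/-- `F` generates `d i` from the first `i` sets, but no set `F \ {a} ∪ Y` does. -/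
structure IsCriticalChain (G : SimpleGraph V) (β : ℕ → Set V) (d : ℕ → V) (i : ℕ) (Y : Set V)
    (F : Finset V) : Prop where
  card : F.card = i + 1
  generated : Generated G β (Finset.range i) F (d i)
  subset : (F : Set V) ⊆ initialPart β d i
  subset' : Y ⊆ initialPart β d i
  notMem : ∀ y ∈ Y, y ∉ F
  avoid : ∀ a ∈ F, ∃ T, BlockClosed G β (Finset.range i) T ∧ T ⊆ initialPart β d i ∧
    d i ∉ T ∧ (∀ x ∈ F, x ≠ a → x ∈ T) ∧ Y ⊆ T

theorem isCriticalChain_zero : IsCriticalChain G β d 0 ∅ {d 0} where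
  card := by simp
  generated := .base (by simp)
  subset := by simp [initialPart]
  subset' := by simp
  notMem := by simp
  avoid a ha := ⟨∅, by simp [BlockClosed], by simp, by simp, by grind, by simp⟩

/-- Once `d i` is generated, the edge from `d i` to `q` fires `β i`. The set `Y'` is independent and
has no neighbour in `{d i, q}`, so adding it fires nothing while `d i` or `q` is missing. -/
theorem IsCriticalChain.extend [DecidableEq V] (hβ : IsBlockChain G l β) (hd : IsLinking l β d)
    {i : ℕ} {Y Y' : Set V} {F : Finset V} (h : IsCriticalChain G β d i Y F) (hi : i < l) {q : V}
    (hq : q ∈ β i) (hdq : G.Adj (d i) q) (hqd : q ≠ d (i + 1)) (hqY : q ∉ Y') (hY : Y' ⊆ β i)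
    (hdY : d i ∉ Y') (hdY' : d (i + 1) ∉ Y') (hYq : ∀ y ∈ Y', ¬ G.Adj q y)
    (hYd : ∀ y ∈ Y', ¬ G.Adj (d i) y) (hYY : ∀ y ∈ Y', ∀ y' ∈ Y', ¬ G.Adj y y') :
    IsCriticalChain G β d (i + 1) (Y ∪ Y') (insert q F) := by
  have hqi : q ∉ initialPart β d i := fun hm => hdq.ne (hd.eq_of_mem hβ hm hq).symm
  have hYi : ∀ y ∈ Y', y ∉ initialPart β d i := fun y hy hm =>
    hdY (hd.eq_of_mem hβ hm (hY hy) ▸ hy)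
  have hsub := initialPart_mono (β := β) (d := d) (Nat.le_succ i)
  have hβi : β i ⊆ initialPart β d (i + 1) := fun x hx => Or.inr ⟨i, by omega, hx⟩
  have hd1 := hd.notMem_initialPart hβ hi
  have hβj : ∀ j < i, β j ⊆ initialPart β d i := fun j hj x hx => Or.inr ⟨j, hj, hx⟩
  refine ⟨?_, ?_, ?_, ?_, ?_, ?_⟩
  · rw [Finset.card_insert_of_notMem fun hm => hqi (h.subset hm), h.card]
  · refine .step (Finset.mem_range.2 (Nat.lt_succ_self i)) (hd.left i hi) hq hdq (hd.right i hi)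
      (h.generated.mono (by simp) (by simp)) (.base (by simp))
  · rw [Finset.coe_insert, Set.insert_subset_iff]
    exact ⟨hβi hq, h.subset.trans hsub⟩
  · exact Set.union_subset (h.subset'.trans hsub) (hY.trans hβi)
  · rintro y (hy | hy)
    · have h1 := h.notMem y hy
      have h2 : y ≠ q := fun e => hqi (e ▸ h.subset' hy)
      simp [h1, h2]
    · have h1 : y ∉ F := fun hm => hYi y hy (h.subset hm)
      have h2 : y ≠ q := fun e => hqY (e ▸ hy)
      simp [h1, h2]
  · intro a ha
    rcases Finset.mem_insert.1 ha with rfl | ha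
    -- Without `q`, everything before `β i` may be present: in `β i` only `d i` and `Y'` appear,
    -- with no edge among them.
    · refine ⟨initialPart β d i ∪ Y', ?_, Set.union_subset hsub (hY.trans hβi), ?_, ?_, ?_⟩
      · intro j hj u hu v hv huv huT hvT
        by_cases hji : j = i
        · subst hji
          have key : ∀ u ∈ β j, u ∈ initialPart β d j ∪ Y' → u = d j ∨ u ∈ Y' :=
            fun u hu hm => hm.imp (fun hm => hd.eq_of_mem hβ hm hu) id
          rcases key u hu huT with rfl | huY <;> rcases key v hv hvT with rfl | hvY
          · exact absurd huv (G.loopless.irrefl _)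
          · exact absurd huv (hYd _ hvY)
          · exact absurd huv.symm (hYd _ huY)
          · exact absurd huv (hYY _ huY _ hvY)
        · have := Finset.mem_range.1 hj
          exact (hβj j (by omega)).trans Set.subset_union_left
      · rintro (hm | hm)
        · exact hd1 hm
        · exact hdY' hm
      · intro x hx hxa
        exact Or.inl (h.subset ((Finset.mem_insert.1 hx).resolve_left hxa))
      · exact Set.union_subset_union_left _ h.subset'
    · obtain ⟨T, hT, hTi, hdT, hFT, hYT⟩ := h.avoid a ha
      have hnot : ∀ u ∈ insert q Y', u ∉ initialPart β d i := by
        rintro u (rfl | hu)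
        · exact hqi
        · exact hYi u hu
      -- Without an earlier vertex `a`, the old `T` misses `d i` and thus all of `β i`, so only `q`
      -- and `Y'` appear there.
      refine ⟨T ∪ insert q Y', ?_, ?_, ?_, ?_, ?_⟩
      · intro j hj u hu v hv huv huT hvT
        by_cases hji : j = i
        · subst hji
          have key : ∀ u ∈ β j, u ∈ T ∪ insert q Y' → u = q ∨ u ∈ Y' := by
            rintro u hu (hm | hm)
            · exact absurd (hd.eq_of_mem hβ (hTi hm) hu ▸ hm) hdT
            · exact hm
          rcases key u hu huT with rfl | huY <;> rcases key v hv hvT with rfl | hvY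
          · exact absurd huv (G.loopless.irrefl _)
          · exact absurd huv (hYq _ hvY)
          · exact absurd huv.symm (hYq _ huY)
          · exact absurd huv (hYY _ huY _ hvY)
        · have hj := Finset.mem_range.1 hj
          have hji : j < i := by omega
          exact (hT j (Finset.mem_range.2 hji) u hu v hv huv
            (huT.resolve_right fun hm => hnot u hm (hβj j hji hu))
            (hvT.resolve_right fun hm => hnot v hm (hβj j hji hv))).trans Set.subset_union_left
      · refine Set.union_subset (hTi.trans hsub) (Set.insert_subset_iff.2 ⟨hβi hq, hY.trans hβi⟩)
      · rintro (hm | rfl | hm)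
        · exact hd1 (hTi hm)
        · exact hqd rfl
        · exact hdY' hm
      · intro x hx hxa
        rcases Finset.mem_insert.1 hx with rfl | hx
        · exact Or.inr (Or.inl rfl)
        · exact Or.inl (hFT x hx hxa)
      · exact Set.union_subset_union hYT (Set.subset_insert _ _)

theorem IsCriticalChain.exists_of_le (hβ : IsBlockChain G l β) (hd : IsLinking l β d)
    {r i : ℕ} {Y : Set V} {F : Finset V} (h : IsCriticalChain G β d r Y F) (hri : r ≤ i)
    (hi : i ≤ l) : ∃ F', IsCriticalChain G β d i Y F' := by
  classical
  induction i, hri using Nat.le_induction with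
  | base => exact ⟨F, h⟩
  | succ i hri ih =>
    obtain ⟨F', hF⟩ := ih (by omega)
    obtain ⟨q, hq, hdq, hqd⟩ := hβ.exists_adj i (d i) (hd.left i hi) (d (i + 1))
    refine ⟨insert q F', ?_⟩
    simpa using hF.extend hβ hd hi hq hdq hqd (Y' := ∅) (by simp) (by simp) (by simp) (by simp)
      (by simp) (by simp) (by simp)

/-! ### Lower bounds -/

theorem IsBlockChain.le_exchangeNumber [Finite V] [Nonempty V] (hβ : IsBlockChain G l β)
    {F : Finset V} {p t : V} (hp : p ∉ F) (ht : Generated G β (Finset.range l) F t)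
    (h : ∀ a ∈ F, ∃ T, BlockClosed G β (Finset.range l) T ∧ t ∉ T ∧ p ∈ T ∧
      ∀ x ∈ F, x ≠ a → x ∈ T) : F.card + 1 ≤ exchangeNumber G := by
  classical
  refine (exchangeNumber_isGreatest G).2 ⟨insert p F, ⟨⟨p, by simp⟩, Or.inr ⟨p, by simp, ?_⟩⟩,
    Finset.card_insert_of_notMem hp⟩
  have hF : ((insert p F : Finset V) : Set V) \ {p} = F := by
    ext x
    simp
    grind
  rw [hF, Set.not_subset]
  refine ⟨t, hβ.mem_cycleHull_iff.2 ht, ?_⟩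
  simp only [Set.mem_iUnion, not_exists]
  intro a ha hta
  obtain ⟨T, hT, htT, hpT, hFT⟩ := h a ha
  refine htT (cycleHull_subset G ((hβ.convex_iff T).2 hT) ?_ hta)
  rintro x ⟨hx, hxa⟩
  rcases Finset.mem_insert.1 hx with rfl | hx
  · exact hpT
  · exact hFT x hx hxa

theorem IsBlockChain.add_one_le_exchangeNumber [Finite V] [Nonempty V] (hβ : IsBlockChain G l β)
    (hl : 0 < l) : l + 1 ≤ exchangeNumber G := by
  obtain ⟨a, ha, -, ha'⟩ := hβ.exists_mem_first hl (Classical.arbitrary V)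
  obtain ⟨b, hb, hba, hb'⟩ := hβ.exists_mem_last hl a
  obtain ⟨d, hd, rfl, hdl⟩ := hβ.exists_isLinking ha ha' hb hb' fun _ => hba.symm
  -- The chain stops at `d (l - 1)` with `l` vertices, and `d l` is the pivot. As `T` misses the
  -- last block, `d l` alone fires nothing there.
  obtain ⟨F, hF⟩ := isCriticalChain_zero.exists_of_le hβ hd (Nat.zero_le (l - 1)) (by omega)
  have hd1 := hd.notMem_initialPart hβ (show l - 1 < l by omega)
  rw [show l - 1 + 1 = l by omega] at hd1
  have hcard := hF.card
  have hmono : Finset.range (l - 1) ⊆ Finset.range l := by simp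
  refine le_trans (by omega) (hβ.le_exchangeNumber (F := F) (p := d l) (t := d (l - 1))
    (fun h => hd1 (hF.subset h)) (hF.generated.mono hmono le_rfl) fun a ha => ?_)
  obtain ⟨T, hT, hTi, hdT, hFT, -⟩ := hF.avoid a ha
  refine ⟨insert (d l) T, ?_, ?_, by simp, fun x hx hxa => Or.inr (hFT x hx hxa)⟩
  · intro j hj u hu v hv huv huT hvT
    have hj := Finset.mem_range.1 hj
    by_cases hjl : j = l - 1
    · subst hjl
      have key : ∀ u ∈ β (l - 1), u ∈ insert (d l) T → u = d l := fun u hu hm =>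
        hm.resolve_right fun hm => hdT (hd.eq_of_mem hβ (hTi hm) hu ▸ hm)
      exact absurd ((key u hu huT).trans (key v hv hvT).symm) huv.ne
    · have key : ∀ u ∈ β j, u ∈ insert (d l) T → u ∈ T := fun u hu hm =>
        hm.resolve_left fun e => hb' j hjl (hdl ▸ e ▸ hu)
      exact (hT j (Finset.mem_range.2 (by omega)) u hu v hv huv (key u hu huT)
        (key v hv hvT)).trans (Set.subset_insert _ _)
  · rintro (h | h)
    · exact hd.ne (l - 1) (by omega) (by rwa [show l - 1 + 1 = l by omega])
    · exact hdT h

/-- A vertex `y` of `β r` separated from `d r` and a neighbour `x` of `d r` serves as a pivot. -/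
theorem IsLinking.add_two_le_exchangeNumber [Finite V] [Nonempty V] (hd : IsLinking l β d)
    (hβ : IsBlockChain G l β) {r : ℕ} {x y : V} (hx : x ∈ β r) (hy : y ∈ β r)
    (hdx : G.Adj (d r) x) (hdy : ¬ G.Adj (d r) y) (hxy : ¬ G.Adj x y) (hne : x ≠ y)
    (hyd : y ≠ d r) (hyd' : y ≠ d (r + 1)) (hxd' : x ≠ d (r + 1)) :
    l + 2 ≤ exchangeNumber G := by
  classical
  have hr := hβ.lt_of_mem hx
  obtain ⟨F₀, hF₀⟩ := isCriticalChain_zero.exists_of_le hβ hd (Nat.zero_le r) hr.le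
  -- At block `r` the neighbour used is `x`, and `y` is carried along; the full chain of `l + 1`
  -- vertices together with the pivot `y` gives `l + 2`.
  have h1 := hF₀.extend hβ hd hr hx hdx hxd' (Y' := {y}) (by simpa) (by simpa)
    (by simpa using hyd.symm) (by simpa using hyd'.symm) (by simpa) (by simpa) (by simp)
  obtain ⟨F, hF⟩ := h1.exists_of_le hβ hd hr le_rfl
  have hcard := hF.card
  refine le_trans (by omega) (hβ.le_exchangeNumber (F := F) (p := y) (t := d l)
    (hF.notMem y (by simp)) hF.generated fun a ha => ?_)
  obtain ⟨T, hT, -, hdT, hFT, hYT⟩ := hF.avoid a ha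
  exact ⟨T, hT, hdT, hYT (by simp), hFT⟩

/-- When the chain on the left of `β r` is broken, all blocks on the right may be filled: `β r` then
contains only `y` and `d (r + 1)`, which are not adjacent, and does not fire. -/
theorem IsCriticalChain.exists_avoid (hβ : IsBlockChain G l β) (hd : IsLinking l β d) {r : ℕ}
    (hr : r + 1 < l) {F : Finset V} (hF : IsCriticalChain G β d r ∅ F) {y t : V}
    (hy : y ∈ β r) (hy' : ∀ j, j ≠ r → y ∉ β j) (hdy : ¬ G.Adj (d (r + 1)) y)
    (ht : t ∈ β r) (htd : t ≠ d r) (htd' : t ≠ d (r + 1)) (hty : t ≠ y) {a : V} (ha : a ∈ F) :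
    ∃ T, BlockClosed G β (Finset.range l) T ∧ t ∉ T ∧ y ∈ T ∧ (∀ x ∈ F, x ≠ a → x ∈ T) ∧
      ∀ j, r < j → β j ⊆ T := by
  obtain ⟨T, hT, hTi, hdT, hFT, -⟩ := hF.avoid a ha
  have hlast : ∀ u ∈ β r, (∃ j, r < j ∧ u ∈ β j) → u = d (r + 1) := by
    rintro u hu ⟨j, hj, huj⟩
    have := hβ.eq_add_one_or hu huj (by omega)
    obtain rfl : j = r + 1 := by omega
    exact hβ.inter _ _ (by omega) ⟨hu, huj⟩ ⟨hd.right r (by omega), hd.left _ hr⟩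
  have hTr : ∀ u ∈ β r, u ∉ T := fun u hu hm => hdT (hd.eq_of_mem hβ (hTi hm) hu ▸ hm)
  refine ⟨T ∪ (insert y {x | ∃ j, r < j ∧ x ∈ β j}), ?_, ?_, Or.inr (Or.inl rfl),
    fun x hx hxa => Or.inl (hFT x hx hxa), fun j hj x hx => Or.inr (Or.inr ⟨j, hj, hx⟩)⟩
  · intro j hj u hu v hv huv huT hvT
    rcases lt_trichotomy j r with hjr | rfl | hjr
    · have key : ∀ u ∈ β j, u ∈ T ∪ (insert y {x | ∃ j, r < j ∧ x ∈ β j}) → u ∈ T := by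
        rintro u hu (hm | rfl | ⟨k, hk, huk⟩)
        · exact hm
        · exact absurd hu (hy' j hjr.ne)
        · exact absurd huk (Set.disjoint_left.1 (hβ.disjoint j k (by omega)) hu)
      exact (hT j (Finset.mem_range.2 hjr) u hu v hv huv (key u hu huT)
        (key v hv hvT)).trans Set.subset_union_left
    · have key : ∀ u ∈ β j, u ∈ T ∪ (insert y {x | ∃ k, j < k ∧ x ∈ β k}) →
          u = y ∨ u = d (j + 1) := by
        rintro u hu (hm | hm | hm)
        · exact absurd hm (hTr u hu)
        · exact Or.inl hm
        · exact Or.inr (hlast u hu hm)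
      rcases key u hu huT with rfl | rfl <;> rcases key v hv hvT with rfl | rfl
      · exact absurd huv (G.loopless.irrefl _)
      · exact absurd huv.symm hdy
      · exact absurd huv hdy
      · exact absurd huv (G.loopless.irrefl _)
    · exact fun x hx => Or.inr (Or.inr ⟨j, hjr, hx⟩)
  · rintro (hm | hm | hm)
    · exact hTr t ht hm
    · exact hty hm
    · exact htd' (hlast t ht hm)

/-- A vertex `y` of `β r` separated from two adjacent linking vertices serves as a pivot. -/
theorem IsLinking.add_two_le_exchangeNumber_of_adj [Finite V] [Nonempty V] (hd : IsLinking l β d)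
    (hβ : IsBlockChain G l β) {r : ℕ} (hr0 : 0 < r) (hr : r + 1 < l) {y t : V} (hy : y ∈ β r)
    (hy' : ∀ j, j ≠ r → y ∉ β j) (hdd : G.Adj (d r) (d (r + 1))) (hdy : ¬ G.Adj (d r) y)
    (hdy' : ¬ G.Adj (d (r + 1)) y) (ht : t ∈ β r) (htd : t ≠ d r) (htd' : t ≠ d (r + 1))
    (hty : t ≠ y) : l + 2 ≤ exchangeNumber G := by
  classical
  have e1 : l - (l - 1 - r) = r + 1 := by omega
  have e2 : l - (l - 1 - r + 1) = r := by omega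
  have e3 : l - 1 - (l - 1 - r) = r := by omega
  -- Chains from the two ends, with `r + 1` and `l - r` vertices, generate `d r` and `d (r + 1)`.
  -- This edge fires `β r` and yields `t`.
  obtain ⟨F₁, hF₁⟩ := isCriticalChain_zero.exists_of_le hβ hd (Nat.zero_le r) (by omega)
  obtain ⟨F₂, hF₂⟩ := isCriticalChain_zero.exists_of_le hβ.reverse hd.reverse
    (Nat.zero_le (l - 1 - r)) (by omega)
  have hmem : ∀ z ∈ β r, z ∈ reverseChain l β (l - 1 - r) := fun z hz =>
    ⟨by omega, by rwa [e3]⟩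
  have h1 : ∀ x ∈ F₁, ∃ j < r, x ∈ β j := by
    intro x hx
    rcases hF₁.subset hx with rfl | h
    · exact ⟨0, hr0, hd.left 0 (by omega)⟩
    · exact h
  have h2 : ∀ x ∈ F₂, ∃ j, r < j ∧ x ∈ β j := by
    intro x hx
    rcases hF₂.subset hx with rfl | ⟨j, hj, hx⟩
    · exact ⟨l - 1, by omega, (hd.reverse.left 0 (by omega)).2⟩
    · exact ⟨l - 1 - j, by omega, hx.2⟩
  have hdisj : Disjoint F₁ F₂ := by
    rw [Finset.disjoint_left]
    intro x hx hx'
    obtain ⟨j, hj, hxj⟩ := h1 x hx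
    obtain ⟨k, hk, hxk⟩ := h2 x hx'
    exact Set.disjoint_left.1 (hβ.disjoint j k (by omega)) hxj hxk
  have hcard : (F₁ ∪ F₂).card = l + 1 := by
    rw [Finset.card_union_of_disjoint hdisj, hF₁.card, hF₂.card]
    omega
  have hyF : y ∉ F₁ ∪ F₂ := by
    intro hm
    rcases Finset.mem_union.1 hm with hm | hm
    · obtain ⟨j, hj, hyj⟩ := h1 y hm
      exact hy' j (by omega) hyj
    · obtain ⟨j, hj, hyj⟩ := h2 y hm
      exact hy' j (by omega) hyj
  have hgen₂ : Generated G β (Finset.range l) F₂ (d (r + 1)) := by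
    have := hF₂.generated.of_reverseChain
    simpa only [e1] using this
  have hgen : Generated G β (Finset.range l) (F₁ ∪ F₂ : Finset V) t := by
    refine .step (Finset.mem_range.2 (by omega)) (hd.left r (by omega)) (hd.right r (by omega))
      hdd ht (hF₁.generated.mono ?_ (by simp)) (hgen₂.mono le_rfl (by simp))
    simp only [Finset.range_subset_range]
    omega
  refine le_trans (by omega) (hβ.le_exchangeNumber hyF hgen fun a ha => ?_)
  rcases Finset.mem_union.1 ha with ha | ha
  · obtain ⟨T, hT, htT, hyT, hFT, hβT⟩ :=
      hF₁.exists_avoid hβ hd hr hy hy' hdy' ht htd htd' hty ha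
    refine ⟨T, hT, htT, hyT, fun x hx hxa => ?_⟩
    rcases Finset.mem_union.1 hx with hx | hx
    · exact hFT x hx hxa
    · obtain ⟨j, hj, hxj⟩ := h2 x hx
      exact hβT j hj hxj
  · obtain ⟨T, hT, htT, hyT, hFT, hβT⟩ :=
      hF₂.exists_avoid hβ.reverse hd.reverse (by omega) (hmem y hy)
        (fun j hj hyj => hy' (l - 1 - j) (by have := hyj.1; omega) hyj.2) (by simpa only [e2])
        (hmem t ht) (by simpa only [e1]) (by simpa only [e2]) hty ha
    refine ⟨T, blockClosed_reverseChain.1 hT, htT, hyT, fun x hx hxa => ?_⟩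
    rcases Finset.mem_union.1 hx with hx | hx
    · obtain ⟨j, hj, hxj⟩ := h1 x hx
      exact hβT (l - 1 - j) (by omega) ⟨by omega, by rwa [show l - 1 - (l - 1 - j) = j by omega]⟩
    · exact hFT x hx hxa

/-- Every linking passes through `c`, so `x` can be the chosen neighbour of `c` unless it is the
next linking vertex. In the last block that vertex is free and is taken to be a neighbour `t` of
`y`, which differs from `c`, `x` and `y`. In an inner block `x` may be the next cut vertex, and then
the two-sided chain is used. -/
theorem IsBlockChain.add_two_le_of_mem_prev [Finite V] [Nonempty V] (hβ : IsBlockChain G l β)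
    {r : ℕ} {c x y : V} (hc : c ∈ β r) (hc' : c ∈ β (r + 1)) (hx : x ∈ β (r + 1))
    (hy : y ∈ β (r + 1)) (hy' : ∀ j, j ≠ r + 1 → y ∉ β j) (hcx : G.Adj c x) (hcy : ¬ G.Adj c y)
    (hxy : ¬ G.Adj x y) (hne : x ≠ y) : l + 2 ≤ exchangeNumber G := by
  have hr := hβ.lt_of_mem hc'
  obtain ⟨t, ht, hyt, -⟩ := hβ.exists_adj _ y hy y
  have hyc : y ≠ c := fun e => hy' r (by omega) (e ▸ hc)
  have htc : t ≠ c := fun e => hcy (e ▸ hyt.symm)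
  have htx : t ≠ x := fun e => hxy (e ▸ hyt.symm)
  obtain ⟨a, ha, -, ha'⟩ := hβ.exists_mem_first (by omega) c
  have hdr : ∀ d, IsLinking l β d → d (r + 1) = c := fun d hd =>
    hβ.inter r (r + 1) (by omega) ⟨hd.right r (by omega), hd.left _ hr⟩ ⟨hc, hc'⟩
  by_cases hrl : r + 1 = l - 1
  · have ht' : ∀ j, j ≠ l - 1 → t ∉ β j := by
      intro j hj htj
      have h1 := hβ.eq_add_one_or ht htj (by omega)
      have h2 := hβ.lt_of_mem htj
      obtain rfl : j = r := by omega
      exact htc (hβ.inter j (j + 1) (by omega) ⟨htj, ht⟩ ⟨hc, hc'⟩)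
    obtain ⟨d, hd, -, hdl⟩ := hβ.exists_isLinking ha ha' (hrl ▸ ht) ht' (by omega)
    have e := hdr d hd
    have e' : d (r + 1 + 1) = t := by rwa [hrl, show l - 1 + 1 = l by omega]
    exact hd.add_two_le_exchangeNumber hβ hx hy (by rwa [e]) (by rwa [e]) hxy hne (by rwa [e])
      (by rw [e']; exact hyt.ne) (by rw [e']; exact htx.symm)
  · obtain ⟨b, hb, hba, hb'⟩ := hβ.exists_mem_last (by omega) a
    obtain ⟨d, hd, -, -⟩ := hβ.exists_isLinking ha ha' hb hb' (by omega)
    have e := hdr d hd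
    have hyd : y ≠ d (r + 1 + 1) := fun h =>
      hy' (r + 1 + 1) (by omega) (h ▸ hd.left _ (by omega))
    by_cases hxd : x = d (r + 1 + 1)
    · subst hxd
      exact hd.add_two_le_exchangeNumber_of_adj hβ (by omega) (by omega) hy hy' (by rwa [e])
        (by rwa [e]) hxy ht (by rwa [e]) htx hyt.ne'
    · exact hd.add_two_le_exchangeNumber hβ hx hy (by rwa [e]) (by rwa [e]) hxy hne (by rwa [e])
        hyd hxd

/-- The vertex-separation property in terms of the chain of blocks. -/
theorem IsBlockChain.add_two_le_of_mem [Finite V] [Nonempty V] (hβ : IsBlockChain G l β)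
    {r k : ℕ} {c x y : V} (hkr : k ≠ r) (hc : c ∈ β r) (hc' : c ∈ β k) (hx : x ∈ β r)
    (hy : y ∈ β r) (hy' : ∀ j, j ≠ r → y ∉ β j) (hcx : G.Adj c x) (hcy : ¬ G.Adj c y)
    (hxy : ¬ G.Adj x y) (hne : x ≠ y) : l + 2 ≤ exchangeNumber G := by
  rcases hβ.eq_add_one_or hc' hc hkr with rfl | rfl
  · exact hβ.add_two_le_of_mem_prev hc' hc hx hy hy' hcx hcy hxy hne
  · have hl := hβ.lt_of_mem hc'
    have e : l - 1 - (l - 1 - (r + 1) + 1) = r := by omega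
    have e' : l - 1 - (l - 1 - (r + 1)) = r + 1 := by omega
    have hmem : ∀ z ∈ β r, z ∈ reverseChain l β (l - 1 - (r + 1) + 1) := fun z hz =>
      ⟨by omega, by rwa [e]⟩
    exact hβ.reverse.add_two_le_of_mem_prev (r := l - 1 - (r + 1)) ⟨by omega, by rwa [e']⟩
      (hmem c hc) (hmem x hx) (hmem y hy)
      (fun j hj hyj => hy' (l - 1 - j) (by have := hyj.1; omega) hyj.2) hcx hcy hxy hne

/-- The edge-vertex property of the first block in terms of the chain of blocks. -/
theorem IsBlockChain.add_two_le_of_first [Finite V] [Nonempty V] (hβ : IsBlockChain G l β)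
    {u v p : V} (hu : u ∈ β 0) (hv : v ∈ β 0) (hp : p ∈ β 0) (hp' : ∀ j, j ≠ 0 → p ∉ β j)
    (huv : G.Adj u v) (hup : ¬ G.Adj u p) (hvp : ¬ G.Adj v p) (hup' : u ≠ p) (hvp' : v ≠ p) :
    l + 2 ≤ exchangeNumber G := by
  -- If an end of the edge lies in another block, it plays the role of `c` in vertex separation.
  -- Otherwise `u` can serve as `d 0`.
  by_cases hu' : ∃ k, k ≠ 0 ∧ u ∈ β k
  · obtain ⟨k, hk, huk⟩ := hu'
    exact hβ.add_two_le_of_mem hk hu huk hv hp hp' huv hup hvp hvp'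
  by_cases hv' : ∃ k, k ≠ 0 ∧ v ∈ β k
  · obtain ⟨k, hk, hvk⟩ := hv'
    exact hβ.add_two_le_of_mem hk hv hvk hu hp hp' huv.symm hvp hup hup'
  push Not at hu' hv'
  have hl := hβ.lt_of_mem hu
  have key : ∀ d, IsLinking l β d → d 0 = u → p ≠ d 1 → v ≠ d 1 → l + 2 ≤ exchangeNumber G := by
    rintro d hd rfl h1 h2
    exact hd.add_two_le_exchangeNumber hβ hv hp huv hup hvp hvp' hup'.symm h1 h2
  by_cases h : l = 1
  · subst h
    -- With a single block `d 1` is free; a neighbour of `p` differs from `u`, `v` and `p`.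
    obtain ⟨t, ht, hpt, -⟩ := hβ.exists_adj _ p hp p
    have hut : u ≠ t := fun e => hup (e ▸ hpt.symm)
    obtain ⟨d, hd, h0, h1⟩ := hβ.exists_isLinking hu hu' (b := t) ht
      (fun j hj htj => hj (by have := hβ.lt_of_mem htj; omega)) fun _ => hut
    exact key d hd h0 (by rw [h1]; exact hpt.ne) (by rw [h1]; exact fun e => hvp (e ▸ hpt.symm))
  · obtain ⟨b, hb, -, hb'⟩ := hβ.exists_mem_last hl u
    obtain ⟨d, hd, h0, -⟩ := hβ.exists_isLinking hu hu' hb hb' fun e => absurd e h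
    have h1 := hd.left 1 (by omega)
    exact key d hd h0 (fun e => hp' 1 (by simp) (e ▸ h1)) fun e => hv' 1 (by simp) (e ▸ h1)

theorem IsBlockChain.add_two_le_of_end [Finite V] [Nonempty V] (hβ : IsBlockChain G l β) {i : ℕ}
    (hi : {c | c ∈ β i ∧ IsCutVertex G c}.Subsingleton) {u v p : V} (hu : u ∈ β i) (hv : v ∈ β i)
    (hp : p ∈ β i) (hp' : ∀ j, j ≠ i → p ∉ β j) (huv : G.Adj u v) (hup : ¬ G.Adj u p)
    (hvp : ¬ G.Adj v p) (hup' : u ≠ p) (hvp' : v ≠ p) : l + 2 ≤ exchangeNumber G := by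
  have hil := hβ.lt_of_mem hu
  rcases Nat.eq_zero_or_pos i with rfl | h0
  · exact hβ.add_two_le_of_first hu hv hp hp' huv hup hvp hup' hvp'
  -- An inner block has cut vertices on both sides. They are distinct because its two neighbouring
  -- blocks are disjoint, so an end block is first or last in the chain.
  by_cases h1 : i + 1 < l
  · obtain ⟨k, rfl⟩ := Nat.exists_eq_add_of_lt h0
    obtain ⟨c, hc, hc1, hc2⟩ := hβ.cut (0 + k) (by omega)
    obtain ⟨c', hc', hc1', hc2'⟩ := hβ.cut (0 + k + 1) (by omega)
    obtain rfl : c = c' := hi ⟨hc2, hc⟩ ⟨hc1', hc'⟩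
    exact absurd hc2' (Set.disjoint_left.1 (hβ.disjoint _ _ (by omega)) hc1)
  · obtain rfl : i = l - 1 := by omega
    have hmem : ∀ z ∈ β (l - 1), z ∈ reverseChain l β 0 := fun z hz => ⟨by omega, hz⟩
    exact hβ.reverse.add_two_le_of_first (hmem u hu) (hmem v hv) (hmem p hp)
      (fun j hj hpj => hp' (l - 1 - j) (by have := hpj.1; omega) hpj.2) huv hup hvp hup' hvp'

/-! ### Conclusion -/

theorem two_le_dist_iff (hconn : G.Connected) {u v : V} :
    2 ≤ G.dist u v ↔ u ≠ v ∧ ¬ G.Adj u v := by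
  rw [ne_eq, ← hconn.dist_eq_zero_iff, ← SimpleGraph.dist_eq_one_iff_adj]
  omega

theorem exchangeNumber_eq_one_of_subsingleton [Finite V] [Nonempty V] [Subsingleton V] :
    exchangeNumber G = 1 := by
  obtain ⟨⟨S, hS, hcard⟩, -⟩ := exchangeNumber_isGreatest G
  have h1 := hS.1.card_pos
  have h2 := Finset.card_le_one_of_subsingleton S
  omega

end CycleConvexity

open CycleConvexity in
theorem mainTheorem2 {V : Type*} [Finite V] (G : SimpleGraph V) (hconn : G.Connected)
    (hchordal : CycleConvexity.IsChordal G) (l : ℕ)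
    (hchain : CycleConvexity.BlocksFormSingleChain G l)
    (hK2 : ∀ B : G.Subgraph, CycleConvexity.IsBlock G B →
      ¬ Nonempty (B.coe ≃g SimpleGraph.completeGraph (Fin 2))) :
    ((∀ B : G.Subgraph, CycleConvexity.IsBlock G B →
        ¬ CycleConvexity.HasVertexSeparationProperty G B ∧
        ¬ CycleConvexity.HasEdgeVertexProperty G B) →
      CycleConvexity.exchangeNumber G = l + 1) ∧
    (((∃ B : G.Subgraph, CycleConvexity.IsBlock G B ∧
          CycleConvexity.HasVertexSeparationProperty G B) ∨
        (∃ B : G.Subgraph, CycleConvexity.IsEndBlock G B ∧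
          ∃ x, ¬ CycleConvexity.IsCutVertex G x ∧ CycleConvexity.EdgeVertexAt G B x)) →
      CycleConvexity.exchangeNumber G = l + 2) := by
  obtain ⟨β, hβ, hidx, hidx'⟩ := exists_isBlockChain hconn hchordal hchain hK2
  have : Nonempty V := hconn.nonempty
  obtain ⟨⟨S, hS, hcard⟩, -⟩ := exchangeNumber_isGreatest G
  constructor
  · intro h
    -- A connected graph without blocks has no edge, so it is a single vertex, with exchange number
    -- `1 = 0 + 1`.
    rcases Nat.eq_zero_or_pos l with rfl | hl
    · have : Subsingleton V := by
        by_contra hV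
        rw [not_subsingleton_iff_nontrivial] at hV
        obtain ⟨v⟩ := hconn.nonempty
        obtain ⟨w, hw⟩ := hconn.preconnected.exists_adj_of_nontrivial v
        obtain ⟨C, hC, -⟩ := (isTwoConnected_induce_pair hw).exists_isBlock
        obtain ⟨i, hi, -⟩ := hidx C hC
        omega
      exact exchangeNumber_eq_one_of_subsingleton
    · refine le_antisymm ?_ (hβ.add_one_le_exchangeNumber hl)
      rw [← hcard]
      refine hβ.card_le_of_forall hl (fun r p hp u hu v hv huv hup hvp hnup => ?_) hS
      by_contra hnvp
      obtain ⟨C, hC, hCr⟩ := hidx' r (hβ.lt_of_mem hp)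
      rw [hCr] at hp hu hv
      exact (h C hC).2 ⟨p, hp, u, v, hC.adj hu hv huv, (two_le_dist_iff hconn).2 ⟨hup, hnup⟩,
        (two_le_dist_iff hconn).2 ⟨hvp, hnvp⟩⟩
  · intro h
    refine le_antisymm (hcard ▸ hβ.card_le hS) ?_
    rcases h with ⟨B, hB, c, x, y, hc, hcB, hxB, hyB, hne, hcx, hy, hcy, hxy⟩ |
      ⟨B, ⟨hB, hend⟩, p, hp, hpB, u, v, huv, hup, hvp⟩
    · obtain ⟨r, hr, hBr⟩ := hidx B hB
      rw [← hBr] at hcB hxB hyB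
      obtain ⟨k, hk, hck⟩ := hβ.exists_of_cut c hc r hcB
      exact hβ.add_two_le_of_mem hk hcB hck hxB hyB
        (fun j hj hyj => hy (hβ.isCutVertex hyj hyB hj)) hcx hcy hxy hne
    · obtain ⟨r, hr, hBr⟩ := hidx B hB
      have hu := B.edge_vert huv
      have hv := B.edge_vert huv.symm
      rw [← hBr] at hend hpB hu hv
      rw [two_le_dist_iff hconn] at hup hvp
      exact hβ.add_two_le_of_end hend hu hv hpB (fun j hj hpj => hp (hβ.isCutVertex hpj hpB hj))
        huv.adj_sub hup.2 hvp.2 hup.1 hvp.1
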